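/- Let $\mathrm{Ai}$, $\mathrm{Bi}$ be the Airy functions. For a complex constant $\vartheta$ put $$\varphi(z;\vartheta)=\cos(\vartheta)\,\mathrm{Ai}(t)+\sin(\vartheta)\,\mathrm{Bi}(t),\qquad t=-2^{-1/3}z,$$ let $\tau_0(z;\vartheta)=1$, let $$\tau_n(z;\vartheta)=\det\left[\frac{d^{\,j+k}}{dz^{\,j+k}}\varphi(z;\vartheta)\right]_{j,k=0}^{n-1}\qquad(n\ge 1),$$ and let $$q_n(z;\vartheta)=\frac{d}{dz}\ln\frac{\tau_{n-1}(z;\vartheta)}{\tau_n(z;\vartheta)}\qquad(n\ge 1),$$ the logarithmic derivative of $\tau_{n-1}/\tau_n$. Then for every integer $n\ge1$ and every $\vartheta\in\mathbb{C}$, as $z\to-\infty$ along the real axis, $$q_n(z;\vartheta)=\begin{cases} \displaystyle-\frac{(-z)^{1/2}}{\sqrt2}+\frac{2n-1}{4z}+\frac{12n^2-12n+5}{16\sqrt2\,(-z)^{5/2}}+\mathcal{O}\left(z^{-4}\right),&\text{if }\sin\vartheta=0\ (\text{in particular if }\vartheta=0),\\[2ex] \displaystyle\frac{(-z)^{1/2}}{\sqrt2}+\frac{2n-1}{4z}-\frac{12n^2-12n+5}{16\sqrt2\,(-z)^{5/2}}+\mathcal{O}\left(z^{-4}\right),&\text{if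 }\sin\vartheta\neq0, \end{cases}$$ where the implied constants may depend on $n$ and $\vartheta$. -/

import Mathlib

open Filter Asymptotics

noncomputable section

/-- The integral `∫ exp (t ^ 3 / 3 - z t) dt` along the ray from `0` to infinity in the direction
`ω`, parametrised by `t = ω r` with `r > 0`. It converges absolutely if `Re (ω ^ 3) < 0`; below only
the directions `exp (± π i / 3)` and `-1` are used, for which `ω ^ 3 = -1`. -/
def airyRay (ω z : ℂ) : ℂ :=
  ∫ r in Set.Ioi (0 : ℝ), Complex.exp ((ω * r) ^ 3 / 3 - z * (ω * r)) * ω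

/-- The Airy function `Ai`, an entire function:
`Ai z = (2 π i)⁻¹ ∫ exp (t ^ 3 / 3 - z t) dt`, where the contour runs from `∞ exp (-π i / 3)`
through `0` to `∞ exp (π i / 3)`. -/
def airyAi (z : ℂ) : ℂ :=
  (2 * Real.pi * Complex.I)⁻¹ *
    (airyRay (Complex.exp (Real.pi * Complex.I / 3)) z
      - airyRay (Complex.exp (-(Real.pi * Complex.I / 3))) z)

/-- The Airy function `Bi`, an entire function:
`Bi z = (2 π)⁻¹ (∫ exp (t ^ 3 / 3 - z t) dt + ∫ exp (t ^ 3 / 3 - z t) dt)`, where the first contour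
runs from `-∞` through `0` to `∞ exp (π i / 3)` and the second one from `-∞` through `0` to
`∞ exp (-π i / 3)`. -/
def airyBi (z : ℂ) : ℂ :=
  (2 * Real.pi : ℂ)⁻¹ *
    ((airyRay (Complex.exp (Real.pi * Complex.I / 3)) z - airyRay (-1) z)
      + (airyRay (Complex.exp (-(Real.pi * Complex.I / 3))) z - airyRay (-1) z))

/-- `φ(z; ϑ) = cos ϑ Ai(t) + sin ϑ Bi(t)` with `t = -2^(-1/3) z`. -/
def airyPhi (ϑ z : ℂ) : ℂ :=
  Complex.cos ϑ * airyAi (-(((2 : ℝ) ^ (-(1 / 3) : ℝ) : ℝ) : ℂ) * z)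
    + Complex.sin ϑ * airyBi (-(((2 : ℝ) ^ (-(1 / 3) : ℝ) : ℝ) : ℂ) * z)

/-- `τ_n(z; ϑ)`, the `n × n` determinant with entries `d^(j+k) φ / dz^(j+k)`, `0 ≤ j, k ≤ n - 1`.
For `n = 0` it is the empty determinant `1`. -/
def airyTau (n : ℕ) (ϑ z : ℂ) : ℂ :=
  Matrix.det (Matrix.of fun j k : Fin n => iteratedDeriv ((j : ℕ) + (k : ℕ)) (airyPhi ϑ) z)

/-- `q_n(z; ϑ) = d/dz ln (τ_{n-1}(z; ϑ) / τ_n(z; ϑ))`, for `n ≥ 1`. The derivative of any branch of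
the logarithm of a function is its logarithmic derivative. -/
def airyQ (n : ℕ) (ϑ z : ℂ) : ℂ :=
  logDeriv (fun w : ℂ => airyTau (n - 1) ϑ w / airyTau n ϑ w) z

end

/-! Put `x = -z`, `q_n(x) = (log τ_{n-1})' - (log τ_n)'` and `u_n(x) = (log τ_n)''`, with the
logarithmic derivatives taken in `z` at `-x`. The Toda equation `u_n = τ_{n+1} τ_{n-1} / τ_n ^ 2`, a
case of the Desnanot–Jacobi identity (`exists_hasDerivAt_hankel`), gives `u_n' = -u_n (q_n -
q_{n+1})` and `q_{n+1}' = u_{n+1} - u_n`. By induction (`AirySystem.succ`) the pair solves `q' = q ^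
2 - x / 2 + 2 u`, `u' = -2 q u + n / 2`. Comparing the two formulas for `u_n'` gives the Bäcklund
relation `u_n (q_n + q_{n+1}) = n / 2`.

All expansions are in powers of `P⁻¹`, where `P = σ √(x / 2)`, with `σ = -1` if `sin ϑ = 0` and `σ =
1` otherwise; the error `O(z ^ (-4))` is `O(P⁻¹ ^ 8)`. If `q_n` is known to this order, the linear
equation for `u_n` determines `u_n` up to `O(P⁻¹ ^ 10)` (`AirySystem.isBigO_u_sub`). Since `u_n ~ n
/ (4 P)`, division costs two powers of `P`, so `q_{n+1} = -q_n + n / (2 u_n)` is again known up to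
`O(P⁻¹ ^ 8)`. The same asymptotics give `u_n ≠ 0`, hence `τ_{n+1} ≠ 0`, for large `x`, which keeps
the induction going.

For `n = 1`, `q_1 = y' / y` with `y(x) = φ(-x)` and `y'' = (x / 2) y`. If `sin ϑ ≠ 0`, `y` is
unbounded and the error in the Riccati equation solves a stable linear equation
(`isBigO_div_sub_of_unbounded`). If `sin ϑ = 0`, `y` is bounded and nonzero, and `y' - Q y`, with
`Q` the approximation, is the solution of moderate growth of an unstable linear equation
(`isBigO_div_sub_of_bounded`). The analytic input is thus only that `Ai` is bounded and `|Bi| → ∞`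
on the positive axis; no steepest descent is needed. -/

/-! ### Hankel determinants and the Toda equation -/

/-- The derivative of a determinant, column by column. -/
theorem hasDerivAt_det_updateCol {m : ℕ} {M : ℂ → Matrix (Fin m) (Fin m) ℂ}
    {M' : Matrix (Fin m) (Fin m) ℂ} {z : ℂ}
    (h : ∀ i j, HasDerivAt (fun w => M w i j) (M' i j) z) :
    HasDerivAt (fun w => (M w).det)
      (∑ k, ((M z).updateCol k (fun i => M' i k)).det) z := by
  simp only [Matrix.det_apply']
  rw [Finset.sum_comm]
  refine HasDerivAt.fun_sum fun σ _ => ?_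
  have := (HasDerivAt.fun_finsetProd (u := Finset.univ)
    (fun i _ => h (σ i) i)).const_mul (((σ.sign : ℤ) : ℂ))
  refine this.congr_deriv ?_
  rw [Finset.mul_sum]
  refine Finset.sum_congr rfl fun k _ => ?_
  rw [← Finset.mul_prod_erase _ _ (Finset.mem_univ k)]
  have : ∏ x ∈ Finset.univ.erase k, (M z).updateCol k (fun i => M' i k) (σ x) x
      = ∏ x ∈ Finset.univ.erase k, M z (σ x) x :=
    Finset.prod_congr rfl fun x hx => Matrix.updateCol_ne (Finset.ne_of_mem_erase hx)
  rw [this, Matrix.updateCol_self, smul_eq_mul]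
  ring

/-- The exponents `0, 1, …, m - 1, m + e`. -/
def shiftLast (m e : ℕ) (i : Fin (m + 1)) : ℕ := if i = Fin.last m then m + e else i

theorem shiftLast_zero (m : ℕ) (i : Fin (m + 1)) : shiftLast m 0 i = i := by
  unfold shiftLast; split_ifs with h <;> simp [h]

/-- Differentiating a Wronskian-type determinant only shifts the last column. -/
theorem hasDerivAt_det_shift {a : ℕ → ℂ → ℂ} (ha : ∀ k z, HasDerivAt (a k) (a (k + 1) z) z)
    {m : ℕ} (r : Fin (m + 1) → ℕ) (z : ℂ) :
    HasDerivAt (fun w => (Matrix.of fun i j : Fin (m + 1) => a (r i + shiftLast m 0 j) w).det)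
      (Matrix.of fun i j : Fin (m + 1) => a (r i + shiftLast m 1 j) z).det z := by
  have h := hasDerivAt_det_updateCol
    (M := fun w => Matrix.of fun i j : Fin (m + 1) => a (r i + shiftLast m 0 j) w)
    (M' := Matrix.of fun i j : Fin (m + 1) => a (r i + shiftLast m 0 j + 1) z)
    (fun i j => ha _ z)
  convert h using 1
  rw [Finset.sum_eq_single (Fin.last m)]
  · congr 1
    ext i j
    by_cases hj : j = Fin.last m
    · subst hj; simp [shiftLast, add_assoc]
    · simp [hj, shiftLast]
  · intro k _ hk
    have hk' : (k : ℕ) + 1 < m + 1 := by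
      have := Fin.val_lt_last hk
      omega
    have hne : k ≠ ⟨k + 1, hk'⟩ := fun h => by simpa using congrArg Fin.val h
    -- Differentiating column `k` with `k < m` produces a copy of column `k + 1`.
    refine Matrix.det_zero_of_column_eq hne fun i => ?_
    simp [Matrix.updateCol_ne hne.symm, shiftLast_zero, add_assoc]
  · simp

/-- A form of the Desnanot–Jacobi identity, with an invertible corner block. -/
theorem det_fromBlocks_mul_det {ι K : Type*} [Fintype ι] [DecidableEq ι] [Field K]
    (A : Matrix ι ι K) (B : Matrix ι (Fin 2) K) (C : Matrix (Fin 2) ι K)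
    (D : Matrix (Fin 2) (Fin 2) K) (hA : A.det ≠ 0)
    (d : Fin 2 → Fin 2 → K)
    (hd : ∀ k l, d k l = (Matrix.fromBlocks A (B.submatrix id (fun _ : Fin 1 => l))
      (C.submatrix (fun _ : Fin 1 => k) id) (D.submatrix (fun _ => k) (fun _ => l))).det) :
    (Matrix.fromBlocks A B C D).det * A.det = d 0 0 * d 1 1 - d 0 1 * d 1 0 := by
  let _ : Invertible A := A.invertibleOfIsUnitDet (isUnit_iff_ne_zero.2 hA)
  -- Each bordered minor is `det A` times an entry of the Schur complement, so the identity reduces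
  -- to a `2 × 2` determinant.
  have hd' : ∀ k l, d k l = A.det * (D - C * ⅟A * B) k l := by
    intro k l
    rw [hd, Matrix.det_fromBlocks₁₁, Matrix.det_fin_one]
    congr 1
  rw [Matrix.det_fromBlocks₁₁, Matrix.det_fin_two, hd', hd', hd', hd']
  ring

theorem det_eq_det_fromBlocks {m k : ℕ} (f : ℕ → ℕ → ℂ) (r c : Fin (m + k) → ℕ)
    (r' c' : Fin k → ℕ)
    (hr : ∀ i, r (Fin.castAdd k i) = i) (hr' : ∀ i, r (Fin.natAdd m i) = r' i)
    (hc : ∀ i, c (Fin.castAdd k i) = i) (hc' : ∀ i, c (Fin.natAdd m i) = c' i) :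
    (Matrix.of fun i j => f (r i) (c j)).det =
      (Matrix.fromBlocks (Matrix.of fun i j : Fin m => f i j)
        (Matrix.of fun (i : Fin m) (j : Fin k) => f i (c' j))
        (Matrix.of fun (i : Fin k) (j : Fin m) => f (r' i) j)
        (Matrix.of fun (i : Fin k) (j : Fin k) => f (r' i) (c' j))).det := by
  rw [← Matrix.det_submatrix_equiv_self finSumFinEquiv]
  congr 1
  ext i j
  rcases i with i | i <;> rcases j with j | j <;> simp [hr, hr', hc, hc']

/-- Desnanot–Jacobi with the leading `m × m` block as corner: bordering it by row and column `m` or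
`m + 1` amounts to a last exponent shifted by `0` or `1`. -/
theorem det_hankel_mul (f : ℕ → ℂ) (m : ℕ)
    (h : (Matrix.of fun i j : Fin m => f (i + j)).det ≠ 0) :
    (Matrix.of fun i j : Fin (m + 2) => f (i + j)).det
        * (Matrix.of fun i j : Fin m => f (i + j)).det =
      (Matrix.of fun i j => f (shiftLast m 0 i + shiftLast m 0 j)).det
        * (Matrix.of fun i j => f (shiftLast m 1 i + shiftLast m 1 j)).det
      - (Matrix.of fun i j => f (shiftLast m 0 i + shiftLast m 1 j)).det
        * (Matrix.of fun i j => f (shiftLast m 1 i + shiftLast m 0 j)).det := by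
  rw [det_eq_det_fromBlocks (fun i j => f (i + j)) (fun i : Fin (m + 2) => (i : ℕ))
    (fun i : Fin (m + 2) => (i : ℕ)) (fun k => m + k) (fun k => m + k)
    (by simp) (by simp) (by simp) (by simp)]
  refine det_fromBlocks_mul_det _ _ _ _ h
    (fun k l => (Matrix.of fun i j => f (shiftLast m k i + shiftLast m l j)).det) ?_
  intro k l
  have hs : ∀ (e : ℕ) (i : Fin m), shiftLast m e (Fin.castAdd 1 i) = i := by
    intro e i
    have : (Fin.castAdd 1 i) ≠ Fin.last m := Fin.castSucc_ne_last i
    simp [shiftLast, this]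
  have hs' : ∀ (e : ℕ) (i : Fin 1), shiftLast m e (Fin.natAdd m i) = m + e := by
    intro e i
    have : Fin.natAdd m i = Fin.last m := by ext; simp
    simp [shiftLast, this]
  rw [det_eq_det_fromBlocks (fun i j => f (i + j)) (shiftLast m k) (shiftLast m l)
    (fun _ => m + k) (fun _ => m + l) (hs k) (hs' k) (hs l) (hs' l)]
  rfl

/-- The Toda equation for Hankel determinants of successive derivatives. -/
theorem exists_hasDerivAt_hankel {a : ℕ → ℂ → ℂ}
    (ha : ∀ k z, HasDerivAt (a k) (a (k + 1) z) z) (m : ℕ) :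
    ∃ t' t'' : ℂ → ℂ,
      (∀ z, HasDerivAt (fun w => (Matrix.of fun i j : Fin (m + 1) => a (i + j) w).det)
        (t' z) z) ∧
      (∀ z, HasDerivAt t' (t'' z) z) ∧
      ∀ z, (Matrix.of fun i j : Fin m => a (i + j) z).det ≠ 0 →
        (Matrix.of fun i j : Fin (m + 2) => a (i + j) z).det
          * (Matrix.of fun i j : Fin m => a (i + j) z).det =
        (Matrix.of fun i j : Fin (m + 1) => a (i + j) z).det * t'' z - t' z ^ 2 := by
  have symm : ∀ (e e' : ℕ) z,
      (Matrix.of fun i j : Fin (m + 1) => a (shiftLast m e i + shiftLast m e' j) z).det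
      = (Matrix.of fun i j : Fin (m + 1) => a (shiftLast m e' i + shiftLast m e j) z).det := by
    intro e e' z
    rw [← Matrix.det_transpose]
    congr 1
    ext i j
    simp [add_comm]
  refine ⟨fun z => (Matrix.of fun i j => a (shiftLast m 0 i + shiftLast m 1 j) z).det,
    fun z => (Matrix.of fun i j => a (shiftLast m 1 i + shiftLast m 1 j) z).det, ?_, ?_, ?_⟩
  · intro z
    simpa only [shiftLast_zero] using hasDerivAt_det_shift ha (shiftLast m 0) z
  · intro z
    -- The first derivative shifted the last column. By symmetry the shift may be moved to the last
    -- row, which frees the columns for the second derivative.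
    have := hasDerivAt_det_shift ha (shiftLast m 1) z
    simpa only [symm 1 0] using this
  · intro z h
    rw [det_hankel_mul (fun k => a k z) m h]
    rw [symm 1 0 z]
    simp only [shiftLast_zero, sq]

/-! ### Airy integrals: differentiation, Airy's equation, size on the positive axis -/

/-- The moments `∫ t ^ k exp (t ^ 3 / 3 - z t) dt` along the ray in the direction `ω`. -/
noncomputable def airyMoment (ω : ℂ) (k : ℕ) (z : ℂ) : ℂ :=
  ∫ r in Set.Ioi (0 : ℝ), (ω * r) ^ k * Complex.exp ((ω * r) ^ 3 / 3 - z * (ω * r)) * ω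

theorem airyMoment_zero (ω : ℂ) : airyMoment ω 0 = airyRay ω := by
  ext z
  simp [airyMoment, airyRay]

theorem linear_sub_cube_le {b r : ℝ} (hb : 0 ≤ b) (hr : 0 ≤ r) :
    b * r - r ^ 3 / 3 ≤ b * (1 + 3 * b) := by
  rcases le_total (r ^ 2) (3 * b) with h | h
  · have : r ≤ 1 + 3 * b := by nlinarith [sq_nonneg (r - 1)]
    have := mul_le_mul_of_nonneg_left this hb
    have : 0 ≤ r ^ 3 := by positivity
    linarith
  · have := mul_le_mul_of_nonneg_left h hr
    have : 0 ≤ b * (1 + 3 * b) := by positivity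
    nlinarith

theorem norm_exp_cube {ω : ℂ} (h3 : ω ^ 3 = -1) (z : ℂ) (r : ℝ) :
    ‖Complex.exp ((ω * r) ^ 3 / 3 - z * (ω * r))‖
      = Real.exp (-(z * ω).re * r - r ^ 3 / 3) := by
  rw [Complex.norm_exp]
  congr 1
  have : (ω * r) ^ 3 / 3 - z * (ω * r) = ((-(r ^ 3 / 3) : ℝ) : ℂ) - (z * ω) * (r : ℝ) := by
    rw [mul_pow, h3]; push_cast; ring
  rw [this, Complex.sub_re, Complex.re_mul_ofReal, Complex.ofReal_re]
  ring

theorem norm_eq_one_of_cube {ω : ℂ} (h3 : ω ^ 3 = -1) : ‖ω‖ = 1 := by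
  have : ‖ω‖ ^ 3 = 1 := by rw [← norm_pow, h3]; simp
  exact (pow_eq_one_iff_of_nonneg (norm_nonneg _) (by norm_num)).1 this

/-- Raising the linear coefficient from `K` to `K + 2` leaves a factor `exp (-2 r)`: half of it
absorbs `r ^ k ≤ k! exp r`, the other half stays integrable. Only `-Re (z ω)` enters, so the bound
is uniform on half-planes. -/
theorem norm_airyMoment_integrand_le {ω : ℂ} (h3 : ω ^ 3 = -1) (k : ℕ) {z : ℂ} {K r : ℝ}
    (hz : -(z * ω).re ≤ K) (hK : 0 ≤ K) (hr : 0 < r) :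
    ‖(ω * r) ^ k * Complex.exp ((ω * r) ^ 3 / 3 - z * (ω * r)) * ω‖
      ≤ k.factorial * Real.exp ((K + 2) * (1 + 3 * (K + 2))) * Real.exp (-r) := by
  have h1 := norm_eq_one_of_cube h3
  rw [norm_mul, norm_mul, norm_pow, norm_mul, h1, norm_exp_cube h3, one_mul, mul_one,
    Complex.norm_real, Real.norm_of_nonneg hr.le]
  have h2 : r ^ k ≤ k.factorial * Real.exp r := by
    have := Real.pow_div_factorial_le_exp r hr.le k
    rwa [div_le_iff₀' (by positivity)] at this
  have h4 : Real.exp (-(z * ω).re * r - r ^ 3 / 3)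
      ≤ Real.exp ((K + 2) * (1 + 3 * (K + 2)) + -r + -r) := by
    apply Real.exp_le_exp.2
    have := linear_sub_cube_le (b := K + 2) (by positivity) hr.le
    have := mul_le_mul_of_nonneg_right hz hr.le
    linarith
  calc _ ≤ (k.factorial * Real.exp r) * Real.exp ((K + 2) * (1 + 3 * (K + 2)) + -r + -r) := by
        gcongr
    _ = _ := by
        rw [Real.exp_add, Real.exp_add, Real.exp_neg]
        field_simp

theorem integrableOn_exp_bound (C : ℝ) :
    MeasureTheory.IntegrableOn (fun r : ℝ => C * Real.exp (-r)) (Set.Ioi 0) :=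
  (integrableOn_exp_neg_Ioi 0).const_mul C

theorem neg_re_mul_le {ω : ℂ} (h3 : ω ^ 3 = -1) (z : ℂ) : -(z * ω).re ≤ ‖z‖ := by
  have := (neg_le_abs _).trans (Complex.abs_re_le_norm (z * ω))
  rwa [norm_mul, norm_eq_one_of_cube h3, mul_one] at this

theorem integrableOn_airyMoment {ω : ℂ} (h3 : ω ^ 3 = -1) (k : ℕ) (z : ℂ) :
    MeasureTheory.IntegrableOn
      (fun r : ℝ => (ω * r) ^ k * Complex.exp ((ω * r) ^ 3 / 3 - z * (ω * r)) * ω)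
      (Set.Ioi 0) := by
  refine (integrableOn_exp_bound (k.factorial
    * Real.exp ((‖z‖ + 2) * (1 + 3 * (‖z‖ + 2))))).mono' ?_ ?_
  · exact Continuous.aestronglyMeasurable (by fun_prop)
  · filter_upwards [MeasureTheory.ae_restrict_mem measurableSet_Ioi] with r hr
    exact norm_airyMoment_integrand_le h3 k (neg_re_mul_le h3 z) (norm_nonneg z) hr

theorem norm_airyMoment_le {ω : ℂ} (h3 : ω ^ 3 = -1) (k : ℕ) {z : ℂ} {K : ℝ}
    (hz : -(z * ω).re ≤ K) (hK : 0 ≤ K) :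
    ‖airyMoment ω k z‖ ≤ k.factorial * Real.exp ((K + 2) * (1 + 3 * (K + 2))) := by
  refine (MeasureTheory.norm_integral_le_of_norm_le (integrableOn_exp_bound
    (k.factorial * Real.exp ((K + 2) * (1 + 3 * (K + 2))))) ?_).trans_eq ?_
  · filter_upwards [MeasureTheory.ae_restrict_mem measurableSet_Ioi] with r hr
    exact norm_airyMoment_integrand_le h3 k hz hK hr
  · rw [MeasureTheory.integral_const_mul, integral_exp_neg_Ioi_zero, mul_one]

theorem hasDerivAt_airyMoment {ω : ℂ} (h3 : ω ^ 3 = -1) (k : ℕ) (z : ℂ) :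
    HasDerivAt (airyMoment ω k) (-airyMoment ω (k + 1) z) z := by
  have h := hasDerivAt_integral_of_dominated_loc_of_deriv_le (x₀ := z)
    (μ := MeasureTheory.volume.restrict (Set.Ioi (0 : ℝ)))
    (F := fun z (r : ℝ) => (ω * r) ^ k * Complex.exp ((ω * r) ^ 3 / 3 - z * (ω * r)) * ω)
    (F' := fun z (r : ℝ) =>
      -((ω * r) ^ (k + 1) * Complex.exp ((ω * r) ^ 3 / 3 - z * (ω * r)) * ω))
    (bound := fun r => (k + 1).factorial
      * Real.exp ((‖z‖ + 1 + 2) * (1 + 3 * (‖z‖ + 1 + 2))) * Real.exp (-r))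
    -- On the unit ball around `z` the norm is at most `‖z‖ + 1`, which is the `K` used in `bound`.
    (Metric.ball_mem_nhds z one_pos)
    (Eventually.of_forall fun w => (integrableOn_airyMoment h3 k w).aestronglyMeasurable)
    (integrableOn_airyMoment h3 k z)
    (integrableOn_airyMoment h3 (k + 1) z).neg.aestronglyMeasurable ?_
    (integrableOn_exp_bound _) ?_
  · have := h.2
    rwa [MeasureTheory.integral_neg] at this
  · filter_upwards [MeasureTheory.ae_restrict_mem measurableSet_Ioi] with r hr w hw
    rw [norm_neg]
    refine norm_airyMoment_integrand_le h3 (k + 1) ((neg_re_mul_le h3 w).trans ?_)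
      (by positivity) hr
    have := norm_le_norm_add_norm_sub' w z
    rw [Metric.mem_ball, dist_eq_norm] at hw
    linarith [norm_sub_rev w z]
  · refine Eventually.of_forall fun r w _ => ?_
    have h1 : HasDerivAt (fun w : ℂ => (ω * r) ^ 3 / 3 - w * (ω * r)) (-(ω * r)) w := by
      simpa using ((hasDerivAt_id w).mul_const (ω * r)).const_sub ((ω * r) ^ 3 / 3)
    refine ((h1.cexp.const_mul ((ω * r) ^ k)).mul_const ω).congr_deriv ?_
    ring

/-- The integrand is the derivative of `exp (t ^ 3 / 3 - z t)`, which falls from `1` to `0` along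
the ray. The boundary value does not depend on `ω`, so it cancels in differences of rays and these
solve Airy's equation. -/
theorem airyMoment_two {ω : ℂ} (h3 : ω ^ 3 = -1) (z : ℂ) :
    airyMoment ω 2 z - z * airyMoment ω 0 z = -1 := by
  have h2 := integrableOn_airyMoment h3 2 z
  have h0 := integrableOn_airyMoment h3 0 z
  have hderiv : ∀ r : ℝ, HasDerivAt
      (fun r : ℝ => Complex.exp ((ω * r) ^ 3 / 3 - z * (ω * r)))
      ((ω * r) ^ 2 * Complex.exp ((ω * r) ^ 3 / 3 - z * (ω * r)) * ω
        - z * ((ω * r) ^ 0 * Complex.exp ((ω * r) ^ 3 / 3 - z * (ω * r)) * ω)) r := by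
    intro r
    have h1 : HasDerivAt (fun r : ℝ => ω * (r : ℂ)) ω r := by
      simpa using (Complex.ofRealCLM.hasDerivAt (x := r)).const_mul ω
    refine (((h1.pow 3).div_const 3).sub (h1.const_mul z)).cexp.congr_deriv ?_
    simp only [Pi.pow_apply, Pi.sub_apply]
    push_cast
    ring
  have hlim : Tendsto (fun r : ℝ => Complex.exp ((ω * r) ^ 3 / 3 - z * (ω * r)))
      atTop (nhds 0) := by
    rw [tendsto_zero_iff_norm_tendsto_zero]
    have hb := Real.tendsto_exp_neg_atTop_nhds_zero.const_mul
      (((0 : ℕ).factorial : ℝ) * Real.exp ((‖z‖ + 2) * (1 + 3 * (‖z‖ + 2))))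
    rw [mul_zero] at hb
    refine squeeze_zero' (Eventually.of_forall fun _ => norm_nonneg _) ?_ hb
    filter_upwards [eventually_gt_atTop 0] with r hr
    have := norm_airyMoment_integrand_le h3 0 (neg_re_mul_le h3 z) (norm_nonneg z) hr
    rwa [pow_zero, one_mul, norm_mul, norm_eq_one_of_cube h3, mul_one] at this
  have := MeasureTheory.integral_Ioi_of_hasDerivAt_of_tendsto' (a := 0)
    (fun r _ => hderiv r) (h2.sub (h0.const_mul z)) hlim
  rw [MeasureTheory.integral_sub h2 (h0.const_mul z), MeasureTheory.integral_const_mul] at this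
  simpa [airyMoment] using this

theorem cube_exp_pi_div_three : Complex.exp (Real.pi * Complex.I / 3) ^ 3 = -1 := by
  rw [← Complex.exp_nat_mul, ← Complex.exp_pi_mul_I]
  congr 1
  push_cast
  ring

theorem cube_exp_neg_pi_div_three : Complex.exp (-(Real.pi * Complex.I / 3)) ^ 3 = -1 := by
  rw [Complex.exp_neg, inv_pow, cube_exp_pi_div_three]
  norm_num

theorem exp_pi_div_three_eq :
    Complex.exp (Real.pi * Complex.I / 3) = ⟨1 / 2, Real.sqrt 3 / 2⟩ := by
  have : (Real.pi * Complex.I / 3 : ℂ) = ((Real.pi / 3 : ℝ) : ℂ) * Complex.I := by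
    push_cast; ring
  rw [this]
  apply Complex.ext
  · rw [Complex.exp_ofReal_mul_I_re, Real.cos_pi_div_three]
  · rw [Complex.exp_ofReal_mul_I_im, Real.sin_pi_div_three]

theorem exp_neg_pi_div_three_eq :
    Complex.exp (-(Real.pi * Complex.I / 3)) = ⟨1 / 2, -(Real.sqrt 3 / 2)⟩ := by
  have : (-(Real.pi * Complex.I / 3) : ℂ) = ((-(Real.pi / 3) : ℝ) : ℂ) * Complex.I := by
    push_cast; ring
  rw [this]
  apply Complex.ext
  · rw [Complex.exp_ofReal_mul_I_re, Real.cos_neg, Real.cos_pi_div_three]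
  · rw [Complex.exp_ofReal_mul_I_im, Real.sin_neg, Real.sin_pi_div_three]

/-- `Ai` satisfies Airy's equation. -/
theorem exists_hasDerivAt_airyAi :
    ∃ f' : ℂ → ℂ, (∀ z, HasDerivAt airyAi (f' z) z) ∧
      ∀ z, HasDerivAt f' (z * airyAi z) z := by
  have h1 := cube_exp_pi_div_three
  have h2 := cube_exp_neg_pi_div_three
  refine ⟨fun z => (2 * Real.pi * Complex.I)⁻¹ *
    (-airyMoment (Complex.exp (Real.pi * Complex.I / 3)) 1 z
      - -airyMoment (Complex.exp (-(Real.pi * Complex.I / 3))) 1 z), fun z => ?_, fun z => ?_⟩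
  · have := ((hasDerivAt_airyMoment h1 0 z).sub (hasDerivAt_airyMoment h2 0 z)).const_mul
      (2 * Real.pi * Complex.I : ℂ)⁻¹
    simp only [airyMoment_zero] at this
    exact this
  · have := ((hasDerivAt_airyMoment h1 1 z).neg.sub (hasDerivAt_airyMoment h2 1 z).neg).const_mul
      (2 * Real.pi * Complex.I : ℂ)⁻¹
    refine this.congr_deriv ?_
    rw [airyAi, ← airyMoment_zero, ← airyMoment_zero]
    linear_combination (2 * Real.pi * Complex.I : ℂ)⁻¹ * (airyMoment_two h1 z - airyMoment_two h2 z)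

/-- `Bi` satisfies Airy's equation. -/
theorem exists_hasDerivAt_airyBi :
    ∃ f' : ℂ → ℂ, (∀ z, HasDerivAt airyBi (f' z) z) ∧
      ∀ z, HasDerivAt f' (z * airyBi z) z := by
  have h1 := cube_exp_pi_div_three
  have h2 := cube_exp_neg_pi_div_three
  have h3 : (-1 : ℂ) ^ 3 = -1 := by norm_num
  refine ⟨fun z => (2 * Real.pi : ℂ)⁻¹ *
    ((-airyMoment (Complex.exp (Real.pi * Complex.I / 3)) 1 z - -airyMoment (-1) 1 z)
      + (-airyMoment (Complex.exp (-(Real.pi * Complex.I / 3))) 1 z - -airyMoment (-1) 1 z)),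
    fun z => ?_, fun z => ?_⟩
  · have := (((hasDerivAt_airyMoment h1 0 z).sub (hasDerivAt_airyMoment h3 0 z)).add
      ((hasDerivAt_airyMoment h2 0 z).sub (hasDerivAt_airyMoment h3 0 z))).const_mul
      (2 * Real.pi : ℂ)⁻¹
    simp only [airyMoment_zero] at this
    exact this
  · have := (((hasDerivAt_airyMoment h1 1 z).neg.sub (hasDerivAt_airyMoment h3 1 z).neg).add
      ((hasDerivAt_airyMoment h2 1 z).neg.sub (hasDerivAt_airyMoment h3 1 z).neg)).const_mul
      (2 * Real.pi : ℂ)⁻¹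
    refine this.congr_deriv ?_
    simp only [airyBi, ← airyMoment_zero]
    linear_combination (2 * Real.pi : ℂ)⁻¹ * (airyMoment_two h1 z + airyMoment_two h2 z
      - 2 * airyMoment_two h3 z)

/-- For `t ≥ 0` the factor `exp (-t ω r)` has norm at most `1`, so `K = 0` is allowed. -/
theorem exists_norm_airyRay_le {ω : ℂ} (h3 : ω ^ 3 = -1) (hω : 0 ≤ ω.re) :
    ∃ C, ∀ t : ℝ, 0 ≤ t → ‖airyRay ω t‖ ≤ C := by
  refine ⟨Nat.factorial 0 * Real.exp ((0 + 2) * (1 + 3 * (0 + 2))), fun t ht => ?_⟩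
  rw [← airyMoment_zero]
  refine norm_airyMoment_le h3 0 (K := 0) ?_ le_rfl
  rw [Complex.re_ofReal_mul]
  nlinarith

theorem exists_norm_airyAi_le : ∃ C, ∀ t : ℝ, 0 ≤ t → ‖airyAi t‖ ≤ C := by
  obtain ⟨C₁, h₁⟩ := exists_norm_airyRay_le cube_exp_pi_div_three
    (by rw [exp_pi_div_three_eq]; norm_num)
  obtain ⟨C₂, h₂⟩ := exists_norm_airyRay_le cube_exp_neg_pi_div_three
    (by rw [exp_neg_pi_div_three_eq]; norm_num)
  refine ⟨‖(2 * Real.pi * Complex.I : ℂ)⁻¹‖ * (C₁ + C₂), fun t ht => ?_⟩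
  rw [airyAi, norm_mul]
  gcongr
  exact (norm_sub_le _ _).trans (add_le_add (h₁ t ht) (h₂ t ht))

theorem airyRay_neg_one (t : ℝ) :
    airyRay (-1) t = -((∫ r in Set.Ioi (0 : ℝ), Real.exp (t * r - r ^ 3 / 3) : ℝ) : ℂ) := by
  rw [airyRay, ← integral_complex_ofReal, ← MeasureTheory.integral_neg]
  congr 1
  ext r
  push_cast
  rw [mul_neg_one]
  congr 2
  ring

theorem integrableOn_exp_sub_cube (t : ℝ) :
    MeasureTheory.IntegrableOn (fun r : ℝ => Real.exp (t * r - r ^ 3 / 3)) (Set.Ioi 0) := by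
  have h := (integrableOn_airyMoment (ω := -1) (by norm_num) 0 t).norm
  refine h.congr (Eventually.of_forall fun r => ?_)
  simp only [pow_zero, one_mul, norm_mul, norm_neg, norm_one, mul_one]
  rw [norm_exp_cube (by norm_num)]
  simp

/-- On `(1, 2]` the exponent is at least `t - 8 / 3`, and `exp t ≥ t`. This crude bound suffices, as
only `|Bi| → ∞` is needed. -/
theorem mul_le_integral_exp_sub_cube {t : ℝ} (ht : 0 ≤ t) :
    t * Real.exp (-3) ≤ ∫ r in Set.Ioi (0 : ℝ), Real.exp (t * r - r ^ 3 / 3) := by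
  have h1 : ∫ r in Set.Ioc (1 : ℝ) 2, t * Real.exp (-3)
      ≤ ∫ r in Set.Ioc (1 : ℝ) 2, Real.exp (t * r - r ^ 3 / 3) := by
    refine MeasureTheory.setIntegral_mono_on (MeasureTheory.integrableOn_const (by simp))
      ((integrableOn_exp_sub_cube t).mono_set fun r hr => ?_) measurableSet_Ioc fun r hr => ?_
    · exact lt_trans one_pos hr.1
    · have h2 : t ≤ Real.exp t := by linarith [Real.add_one_le_exp t]
      have h3 : r ^ 3 ≤ 2 ^ 3 := pow_le_pow_left₀ (by linarith [hr.1]) hr.2 3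
      calc t * Real.exp (-3) ≤ Real.exp t * Real.exp (-3) := by gcongr
        _ = Real.exp (t - 3) := by rw [← Real.exp_add]; rfl
        _ ≤ _ := by
          apply Real.exp_le_exp.2
          nlinarith [hr.1]
  have h2 : ∫ r in Set.Ioc (1 : ℝ) 2, t * Real.exp (-3) = t * Real.exp (-3) := by
    rw [MeasureTheory.setIntegral_const]
    norm_num [MeasureTheory.Measure.real]
  rw [← h2]
  refine h1.trans (MeasureTheory.setIntegral_mono_set (integrableOn_exp_sub_cube t)
    (Eventually.of_forall fun r => (Real.exp_pos _).le) ?_)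
  exact LE.le.eventuallyLE fun r hr => lt_trans one_pos hr.1

theorem tendsto_norm_airyBi : Tendsto (fun t : ℝ => ‖airyBi t‖) atTop atTop := by
  obtain ⟨C₁, h₁⟩ := exists_norm_airyRay_le cube_exp_pi_div_three
    (by rw [exp_pi_div_three_eq]; norm_num)
  obtain ⟨C₂, h₂⟩ := exists_norm_airyRay_le cube_exp_neg_pi_div_three
    (by rw [exp_neg_pi_div_three_eq]; norm_num)
  have hb : ∀ᶠ t : ℝ in atTop,
      (2 * Real.pi)⁻¹ * (2 * (Real.exp (-3) * t) - (C₁ + C₂)) ≤ ‖airyBi t‖ := by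
    filter_upwards [eventually_ge_atTop 0] with t ht
    have h3 := mul_le_integral_exp_sub_cube ht
    have h4 : ‖(2 : ℂ) * airyRay (-1) t‖
        = 2 * ∫ r in Set.Ioi (0 : ℝ), Real.exp (t * r - r ^ 3 / 3) := by
      rw [airyRay_neg_one, norm_mul, norm_neg, Complex.norm_real, Real.norm_of_nonneg]
      · simp
      · exact le_trans (by positivity) h3
    rw [airyBi, norm_mul]
    have h5 : ‖(2 * Real.pi : ℂ)⁻¹‖ = (2 * Real.pi)⁻¹ := by
      rw [norm_inv, norm_mul, Complex.norm_real, Real.norm_of_nonneg Real.pi_pos.le]; simp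
    rw [h5]
    gcongr
    set a := airyRay (Complex.exp (Real.pi * Complex.I / 3)) t
    set b := airyRay (Complex.exp (-(Real.pi * Complex.I / 3))) t
    set c := airyRay (-1) t
    have h6 : (2 : ℂ) * c = (a + b) - ((a - c) + (b - c)) := by ring
    have h7 := norm_sub_le (a + b) ((a - c) + (b - c))
    rw [← h6, h4] at h7
    linarith [norm_add_le a b, h₁ t ht, h₂ t ht]
  refine tendsto_atTop_mono' _ hb (Tendsto.const_mul_atTop (by positivity) ?_)
  exact tendsto_atTop_add_const_right _ _
    (Tendsto.const_mul_atTop two_pos (Tendsto.const_mul_atTop (Real.exp_pos _) tendsto_id))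

/-- At `0` each ray integral is `ω` times one positive number, and the two directions differ in
their imaginary parts. This excludes that `φ` vanishes identically when `sin ϑ = 0`. -/
theorem airyAi_zero_ne_zero : airyAi 0 ≠ 0 := by
  have hray : ∀ ω : ℂ, ω ^ 3 = -1 →
      airyRay ω 0 = ω * ((∫ r in Set.Ioi (0 : ℝ), Real.exp (0 * r - r ^ 3 / 3) : ℝ) : ℂ) := by
    intro ω h3
    rw [airyRay, MeasureTheory.integral_mul_const, ← integral_complex_ofReal, mul_comm]
    congr 2
    ext r
    rw [mul_pow, h3]
    push_cast
    congr 1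
    ring
  have hpos : 0 < ∫ r in Set.Ioi (0 : ℝ), Real.exp (0 * r - r ^ 3 / 3) := by
    rw [MeasureTheory.integral_pos_iff_support_of_nonneg (fun r => (Real.exp_pos _).le)
      (integrableOn_exp_sub_cube 0)]
    rw [Function.support_eq_univ (fun r => (Real.exp_pos _).ne')]
    simp
  rw [airyAi, hray _ cube_exp_pi_div_three, hray _ cube_exp_neg_pi_div_three, ← sub_mul]
  refine mul_ne_zero (inv_ne_zero ?_) (mul_ne_zero ?_ (by exact_mod_cast hpos.ne'))
  · simp [Real.pi_ne_zero]
  · rw [exp_pi_div_three_eq, exp_neg_pi_div_three_eq]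
    intro h
    have := congrArg Complex.im h
    norm_num at this

/-! ### Stable and unstable linear equations with coefficient of size `√x` -/

theorem eventually_atTop_eventually_nhds {p : ℝ → Prop} (h : ∀ᶠ x in atTop, p x) :
    ∀ᶠ x in atTop, ∀ᶠ y in nhds x, p y := by
  obtain ⟨T, hT⟩ := eventually_atTop.1 h
  filter_upwards [eventually_gt_atTop T] with x hx
  filter_upwards [Ioi_mem_nhds hx] with y hy using hT y hy.le

theorem hasDerivAt_mul_sqrt {x : ℝ} (hx : 0 < x) :
    HasDerivAt (fun x : ℝ => x * Real.sqrt x) (3 / 2 * Real.sqrt x) x := by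
  refine ((hasDerivAt_id x).mul (Real.hasDerivAt_sqrt hx.ne')).congr_deriv ?_
  have h := Real.sq_sqrt hx.le
  have h' := (Real.sqrt_pos.2 hx).ne'
  simp only [id]
  field_simp
  rw [h]
  ring

theorem inner_mul_add (w a r : ℂ) :
    inner ℝ w (a * w + r) = a.re * ‖w‖ ^ 2 + inner ℝ w r := by
  rw [inner_add_right]
  congr 1
  rw [Complex.inner, ← Complex.normSq_eq_norm_sq, Complex.normSq_apply]
  simp
  ring

/-- An energy with integrating factor: `2 / 3 * x ^ (3 / 2)` is a primitive of `√x`. It is used with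
`K = (M / c) ^ 2`, where it becomes monotone. -/
theorem hasDerivAt_exp_mul_normSq {f : ℝ → ℂ} {a r : ℂ} {x : ℝ} (hx : 0 < x)
    (hf : HasDerivAt f (a * f x + r) x) (c K : ℝ) :
    HasDerivAt (fun x => Real.exp (c * (2 / 3 * (x * Real.sqrt x))) * (‖f x‖ ^ 2 - K))
      (Real.exp (c * (2 / 3 * (x * Real.sqrt x))) *
        (c * Real.sqrt x * (‖f x‖ ^ 2 - K)
          + (2 * (a.re * ‖f x‖ ^ 2) + 2 * inner ℝ (f x) r))) x := by
  have h1 := ((((hasDerivAt_mul_sqrt hx).const_mul (2 / 3)).const_mul c).exp).mul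
    (hf.norm_sq.sub_const K)
  refine h1.congr_deriv ?_
  rw [inner_mul_add]
  ring

/-- A function of moderate growth that solves a linear equation with a strongly unstable
coefficient is controlled by the inhomogeneity. -/
theorem norm_le_of_unstable {f a r : ℝ → ℂ} {T c M : ℝ} {k : ℕ} (hT : 0 < T) (hc : 0 < c)
    (hf : ∀ x, T ≤ x → HasDerivAt f (a x * f x + r x) x)
    (ha : ∀ x, T ≤ x → c * Real.sqrt x ≤ (a x).re)
    (hr : ∀ x, T ≤ x → ‖r x‖ ≤ M * Real.sqrt x)
    (hb : f =O[atTop] fun x : ℝ => x ^ k) :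
    ∀ x, T ≤ x → ‖f x‖ ≤ M / c := by
  have hM : 0 ≤ M := by
    have := (norm_nonneg _).trans (hr T le_rfl)
    exact nonneg_of_mul_nonneg_left this (Real.sqrt_pos.2 hT)
  set H : ℝ → ℝ := fun x =>
    Real.exp (-c * (2 / 3 * (x * Real.sqrt x))) * (‖f x‖ ^ 2 - (M / c) ^ 2)
  have hH := fun x (hx : T ≤ x) =>
    hasDerivAt_exp_mul_normSq (hT.trans_le hx) (hf x hx) (-c) ((M / c) ^ 2)
  have hmono : MonotoneOn H (Set.Ici T) := by
    refine monotoneOn_of_deriv_nonneg (convex_Ici T)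
      (fun x hx => (hH x hx).continuousAt.continuousWithinAt)
      (fun x hx => (hH x (interior_subset hx)).differentiableAt.differentiableWithinAt)
      fun x hx => ?_
    have hx : T ≤ x := interior_subset hx
    rw [(hH x hx).deriv]
    refine mul_nonneg (Real.exp_pos _).le ?_
    have h1 := mul_le_mul_of_nonneg_right (ha x hx) (sq_nonneg ‖f x‖)
    have h2 := mul_le_mul_of_nonneg_left (hr x hx) (norm_nonneg (f x))
    have h3 := (abs_le.1 (abs_real_inner_le_norm (f x) (r x))).1
    -- This square is exactly the lower bound that `h1`, `h2` and `h3` give for the second factor of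
    -- the derivative of `H`.
    have h4 : 0 ≤ Real.sqrt x * c * (‖f x‖ - M / c) ^ 2 := by positivity
    have h5 : Real.sqrt x * c * (‖f x‖ - M / c) ^ 2 = -c * Real.sqrt x * (‖f x‖ ^ 2 - (M / c) ^ 2)
        + 2 * (c * Real.sqrt x * ‖f x‖ ^ 2) - 2 * (‖f x‖ * (M * Real.sqrt x)) := by
      field_simp
      ring
    linarith
  -- Polynomial growth of `f` loses against the exponential weight. As `H` increases to `0`, it is
  -- nonpositive, which is the claim.
  have hlim : Tendsto H atTop (nhds 0) := by
    have hg : (fun x => ‖f x‖ ^ 2 - (M / c) ^ 2) =O[atTop] fun x : ℝ => x ^ (2 * k) := by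
      refine IsBigO.sub ?_ ?_
      · simpa only [← pow_mul, mul_comm k 2] using hb.norm_left.pow 2
      · refine IsBigO.of_bound ((M / c) ^ 2) ?_
        filter_upwards [eventually_ge_atTop 1] with x hx
        rw [Real.norm_of_nonneg (by positivity), Real.norm_of_nonneg (by positivity)]
        exact le_mul_of_one_le_right (by positivity) (one_le_pow₀ hx)
    have he : (fun x => Real.exp (-c * (2 / 3 * (x * Real.sqrt x)))) =O[atTop]
        fun x : ℝ => Real.exp (-(2 / 3 * c) * x) := by
      refine IsBigO.of_bound 1 ?_
      filter_upwards [eventually_ge_atTop 1] with x hx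
      rw [one_mul, Real.norm_of_nonneg (Real.exp_pos _).le, Real.norm_of_nonneg (Real.exp_pos _).le]
      apply Real.exp_le_exp.2
      have h1 : 1 ≤ Real.sqrt x := Real.one_le_sqrt.2 hx
      have h2 : x ≤ x * Real.sqrt x := le_mul_of_one_le_right (by linarith) h1
      have h3 := mul_le_mul_of_nonneg_left h2 (by positivity : 0 ≤ 2 / 3 * c)
      linarith
    refine (he.mul hg).trans_tendsto ?_
    have := (isLittleO_pow_exp_pos_mul_atTop (2 * k)
      (by positivity : 0 < 2 / 3 * c)).tendsto_div_nhds_zero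
    refine this.congr fun x => ?_
    rw [neg_mul, Real.exp_neg, div_eq_mul_inv, mul_comm]
  intro x hx
  have h0 : H x ≤ 0 := by
    refine ge_of_tendsto hlim ?_
    filter_upwards [eventually_ge_atTop x] with y hy
    exact hmono hx (hx.trans hy) hy
  have h1 : ‖f x‖ ^ 2 ≤ (M / c) ^ 2 := by
    have := nonpos_of_mul_nonpos_right h0 (Real.exp_pos _)
    linarith
  exact (sq_le_sq₀ (norm_nonneg _) (by positivity)).1 h1

/-- A solution of a linear equation with a strongly stable coefficient is bounded. -/
theorem isBigO_one_of_stable {f a r : ℝ → ℂ} {T c M : ℝ} (hT : 0 < T) (hc : 0 < c)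
    (hf : ∀ x, T ≤ x → HasDerivAt f (a x * f x + r x) x)
    (ha : ∀ x, T ≤ x → (a x).re ≤ -(c * Real.sqrt x))
    (hr : ∀ x, T ≤ x → ‖r x‖ ≤ M * Real.sqrt x) :
    f =O[atTop] fun _ => (1 : ℝ) := by
  set H : ℝ → ℝ := fun x =>
    Real.exp (c * (2 / 3 * (x * Real.sqrt x))) * (‖f x‖ ^ 2 - (M / c) ^ 2)
  have hH := fun x (hx : T ≤ x) =>
    hasDerivAt_exp_mul_normSq (hT.trans_le hx) (hf x hx) c ((M / c) ^ 2)
  have hanti : AntitoneOn H (Set.Ici T) := by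
    refine antitoneOn_of_deriv_nonpos (convex_Ici T)
      (fun x hx => (hH x hx).continuousAt.continuousWithinAt)
      (fun x hx => (hH x (interior_subset hx)).differentiableAt.differentiableWithinAt)
      fun x hx => ?_
    have hx : T ≤ x := interior_subset hx
    rw [(hH x hx).deriv]
    refine mul_nonpos_of_nonneg_of_nonpos (Real.exp_pos _).le ?_
    have h1 := mul_le_mul_of_nonneg_right (ha x hx) (sq_nonneg ‖f x‖)
    have h2 := mul_le_mul_of_nonneg_left (hr x hx) (norm_nonneg (f x))
    have h3 := (abs_le.1 (abs_real_inner_le_norm (f x) (r x))).2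
    have h4 : 0 ≤ Real.sqrt x * c * (‖f x‖ - M / c) ^ 2 := by positivity
    have h5 : Real.sqrt x * c * (‖f x‖ - M / c) ^ 2 = -c * Real.sqrt x * (‖f x‖ ^ 2 - (M / c) ^ 2)
        + 2 * (c * Real.sqrt x * ‖f x‖ ^ 2) - 2 * (‖f x‖ * (M * Real.sqrt x)) := by
      field_simp
      ring
    linarith
  refine IsBigO.of_bound (Real.sqrt ((M / c) ^ 2 + |H T|)) ?_
  filter_upwards [eventually_ge_atTop T] with x hx
  rw [norm_one, mul_one]
  apply Real.le_sqrt_of_sq_le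
  have h1 : H x ≤ |H T| := (hanti Set.self_mem_Ici hx hx).trans (le_abs_self _)
  have hx0 : 0 ≤ x := hT.le.trans hx
  have h2 : 1 ≤ Real.exp (c * (2 / 3 * (x * Real.sqrt x))) := Real.one_le_exp (by positivity)
  by_contra! h
  have h3 : 0 < ‖f x‖ ^ 2 - (M / c) ^ 2 := by linarith [abs_nonneg (H T)]
  have h4 : ‖f x‖ ^ 2 - (M / c) ^ 2 ≤ H x := le_mul_of_one_le_left h3.le h2
  linarith

/-! ### The equation `y'' = (x / 2) y` on the half-line -/

section SecondOrder

variable {y y' : ℝ → ℂ} (hy' : ∀ x : ℝ, HasDerivAt y' ((x / 2 : ℂ) * y x) x)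

include hy' in
theorem isBigO_deriv_of_bounded {C : ℝ} (hb : ∀ x, 0 ≤ x → ‖y x‖ ≤ C) :
    y' =O[atTop] fun x : ℝ => x ^ 2 := by
  have hC : 0 ≤ C := (norm_nonneg _).trans (hb 0 le_rfl)
  have hbound : ∀ x, 1 ≤ x → ‖y' x‖ ≤ (‖y' 0‖ + C) * x ^ 2 := by
    intro x hx
    have := (convex_Icc (0 : ℝ) x).norm_image_sub_le_of_norm_hasDerivWithin_le
      (f := y') (f' := fun x => (x / 2 : ℂ) * y x) (C := x * C)
      (fun t _ => (hy' t).hasDerivWithinAt) (fun t ht => ?_)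
      (Set.left_mem_Icc.2 (by linarith)) (Set.right_mem_Icc.2 (by linarith))
    · rw [sub_zero, Real.norm_of_nonneg (by linarith)] at this
      have h1 := norm_le_norm_add_norm_sub' (y' x) (y' 0)
      have h2 : ‖y' 0‖ ≤ ‖y' 0‖ * x ^ 2 :=
        le_mul_of_one_le_right (norm_nonneg _) (one_le_pow₀ hx)
      nlinarith
    · rw [norm_mul, norm_div, Complex.norm_real, Real.norm_of_nonneg ht.1]
      refine mul_le_mul ?_ (hb t ht.1) (norm_nonneg _) (by linarith)
      have : ‖(2 : ℂ)‖ = 2 := by simp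
      rw [this]
      linarith [ht.1, ht.2]
  refine IsBigO.of_bound (‖y' 0‖ + C) ?_
  filter_upwards [eventually_ge_atTop 1] with x hx
  rw [Real.norm_of_nonneg (by positivity)]
  exact hbound x hx

variable (hy : ∀ x, HasDerivAt y (y' x) x)

include hy hy'

/-- The derivative is `‖y'‖ ^ 2 + (x / 2) ‖y‖ ^ 2`. This function is half the derivative of `‖y‖ ^
2`, so its sign separates bounded from unbounded solutions. -/
theorem monotoneOn_inner_deriv : MonotoneOn (fun x => inner ℝ (y x) (y' x)) (Set.Ici 0) := by
  have h : ∀ x, HasDerivAt (fun x => inner ℝ (y x) (y' x)) _ x := fun x => (hy x).inner ℝ (hy' x)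
  refine monotoneOn_of_deriv_nonneg (convex_Ici 0)
    (fun x hx => (h x).continuousAt.continuousWithinAt)
    (fun x hx => (h x).differentiableAt.differentiableWithinAt) fun x hx => ?_
  have hx : 0 ≤ x := interior_subset hx
  have := inner_mul_add (y x) (x / 2) 0
  rw [add_zero, inner_zero_right, add_zero] at this
  rw [(h x).deriv, this, real_inner_self_eq_norm_sq]
  have : ((x : ℂ) / 2).re = x / 2 := by simp
  rw [this]
  positivity

theorem antitoneOn_norm_of_bounded {C : ℝ} (hb : ∀ x, 0 ≤ x → ‖y x‖ ≤ C) :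
    AntitoneOn (fun x => ‖y x‖) (Set.Ici 0) := by
  have hle : ∀ x, 0 ≤ x → inner ℝ (y x) (y' x) ≤ 0 := by
    intro x hx
    by_contra! hd
    set d := inner ℝ (y x) (y' x)
    have hmono : MonotoneOn (fun t => ‖y t‖ ^ 2 - 2 * d * t) (Set.Ici x) := by
      have h : ∀ t, HasDerivAt (fun t => ‖y t‖ ^ 2 - 2 * d * t)
          (2 * inner ℝ (y t) (y' t) - 2 * d * 1) t :=
        fun t => (hy t).norm_sq.sub ((hasDerivAt_id t).const_mul _)
      refine monotoneOn_of_deriv_nonneg (convex_Ici x)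
        (fun t ht => (h t).continuousAt.continuousWithinAt)
        (fun t ht => (h t).differentiableAt.differentiableWithinAt) fun t ht => ?_
      have ht : x ≤ t := interior_subset ht
      rw [(h t).deriv]
      have : d ≤ inner ℝ (y t) (y' t) := monotoneOn_inner_deriv hy' hy hx (hx.trans ht) ht
      linarith
    have hC : 0 ≤ C := (norm_nonneg _).trans (hb 0 le_rfl)
    -- Since `‖y‖ ^ 2` grows at least at rate `2 d`, at this point it is at least `2 (C ^ 2 + 1)`,
    -- more than `C ^ 2`.
    have hxt : x ≤ x + (C ^ 2 + 1) / d := le_add_of_nonneg_right (by positivity)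
    have h1 := hmono Set.self_mem_Ici hxt hxt
    have h2 := pow_le_pow_left₀ (norm_nonneg _) (hb _ (hx.trans hxt)) 2
    have h3 : 2 * d * (x + (C ^ 2 + 1) / d) = 2 * d * x + 2 * (C ^ 2 + 1) := by
      field_simp
    simp only [h3] at h1
    linarith [sq_nonneg ‖y x‖, sq_nonneg C]
  have hsq : AntitoneOn (fun x => ‖y x‖ ^ 2) (Set.Ici 0) := by
    refine antitoneOn_of_deriv_nonpos (convex_Ici 0)
      (fun t ht => (hy t).norm_sq.continuousAt.continuousWithinAt)
      (fun t ht => (hy t).norm_sq.differentiableAt.differentiableWithinAt) fun t ht => ?_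
    rw [(hy t).norm_sq.deriv]
    linarith [hle t (interior_subset ht)]
  intro s hs t ht hst
  exact (sq_le_sq₀ (norm_nonneg _) (norm_nonneg _)).1 (hsq hs ht hst)

theorem eventually_inner_deriv_pos (hb : Tendsto (fun x => ‖y x‖) atTop atTop) :
    ∀ᶠ x in atTop, 0 < inner ℝ (y x) (y' x) := by
  have hex : ∃ x, 0 ≤ x ∧ 0 < inner ℝ (y x) (y' x) := by
    by_contra! h
    have hsq : AntitoneOn (fun x => ‖y x‖ ^ 2) (Set.Ici 0) := by
      refine antitoneOn_of_deriv_nonpos (convex_Ici 0)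
        (fun t ht => (hy t).norm_sq.continuousAt.continuousWithinAt)
        (fun t ht => (hy t).norm_sq.differentiableAt.differentiableWithinAt) fun t ht => ?_
      rw [(hy t).norm_sq.deriv]
      linarith [h t (interior_subset ht)]
    obtain ⟨x, hx, hx0⟩ := ((hb.eventually_gt_atTop ‖y 0‖).and (eventually_ge_atTop 0)).exists
    have h1 := hsq Set.self_mem_Ici hx0 hx0
    have h2 := (sq_le_sq₀ (norm_nonneg _) (norm_nonneg _)).1 h1
    linarith
  obtain ⟨x₀, hx₀, hpos⟩ := hex
  filter_upwards [eventually_ge_atTop x₀] with x hx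
  exact hpos.trans_le (monotoneOn_inner_deriv hy' hy hx₀ (hx₀.trans hx) hx)

/-- The logarithmic derivative of a bounded solution of `y'' = (x / 2) y` is close to any function
that satisfies the Riccati equation approximately and has the right sign. -/
theorem norm_div_sub_le_of_bounded {C : ℝ} (hb : ∀ x, 0 ≤ x → ‖y x‖ ≤ C) {Q Q' : ℝ → ℂ}
    {T c K : ℝ} (hT : 0 < T) (hc : 0 < c) (hne : ∀ x, T ≤ x → y x ≠ 0)
    (hQ : ∀ x, T ≤ x → HasDerivAt Q (Q' x) x)
    (hre : ∀ x, T ≤ x → c * Real.sqrt x ≤ (-Q x).re)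
    (hres : ∀ x, T ≤ x → ‖Q' x + Q x ^ 2 - x / 2‖ ≤ K * x ^ (-4 : ℤ) * Real.sqrt x)
    (hgrow : Q =O[atTop] fun x : ℝ => x ^ 2) {x : ℝ} (hx : T ≤ x) :
    ‖y' x / y x - Q x‖ ≤ K / c * x ^ (-4 : ℤ) := by
  have hK : 0 ≤ K := by
    have h1 := (norm_nonneg _).trans (hres T le_rfl)
    have h2 : 0 < T ^ (-4 : ℤ) := by positivity
    have h3 := Real.sqrt_pos.2 hT
    exact nonneg_of_mul_nonneg_left (nonneg_of_mul_nonneg_left h1 h3) h2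
  have hx0 : 0 < x := hT.trans_le hx
  -- The interval starts at the given `x`, because `‖y‖` and `t ^ (-4)` decrease from there on. The
  -- bound is then proportional to `‖y x‖`, and dividing by `y x` does not spoil it.
  have key := norm_le_of_unstable (f := fun t => y' t - Q t * y t) (a := fun t => -Q t)
    (r := fun t => -(Q' t + Q t ^ 2 - t / 2) * y t) (T := x) (c := c)
    (M := K * x ^ (-4 : ℤ) * ‖y x‖) (k := 2) hx0 hc ?_ (fun t ht => hre t (hx.trans ht)) ?_ ?_
    x le_rfl
  · have h1 : y' x / y x - Q x = (y' x - Q x * y x) / y x := by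
      have := hne x hx
      field_simp
    rw [h1, norm_div, div_le_iff₀ (norm_pos_iff.2 (hne x hx))]
    refine key.trans_eq ?_
    ring
  · intro t ht
    refine ((hy' t).sub ((hQ t (hx.trans ht)).mul (hy t))).congr_deriv ?_
    ring
  · intro t ht
    have ht0 : 0 < t := hx0.trans_le ht
    rw [norm_mul, norm_neg]
    have h1 := hres t (hx.trans ht)
    have h2 : ‖y t‖ ≤ ‖y x‖ := antitoneOn_norm_of_bounded hy' hy hb hx0.le ht0.le ht
    have h3 : t ^ (-4 : ℤ) ≤ x ^ (-4 : ℤ) := by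
      rw [zpow_neg, zpow_neg]
      refine inv_anti₀ (by positivity) ?_
      exact_mod_cast pow_le_pow_left₀ hx0.le ht 4
    calc _ ≤ (K * t ^ (-4 : ℤ) * Real.sqrt t) * ‖y x‖ :=
          mul_le_mul h1 h2 (norm_nonneg _) ((norm_nonneg _).trans h1)
      _ ≤ (K * x ^ (-4 : ℤ) * Real.sqrt t) * ‖y x‖ := by gcongr
      _ = _ := by ring
  · refine (isBigO_deriv_of_bounded hy' hb).sub ?_
    have h1 : y =O[atTop] fun _ : ℝ => (1 : ℝ) := by
      refine IsBigO.of_bound C ?_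
      filter_upwards [eventually_ge_atTop 0] with t ht
      rw [norm_one, mul_one]
      exact hb t ht
    simpa using hgrow.mul h1

end SecondOrder

/-! ### Calculus of the expansions in powers of `P = ± √(x / 2)` -/

/-- The two branches `± √(x / 2)`, for `σ = ± 1`. -/
noncomputable def branch (σ x : ℝ) : ℂ := ((σ * Real.sqrt (x / 2) : ℝ) : ℂ)

/-- The first three terms of the asymptotic expansion of `q_n`, in terms of `P = ± √(x / 2)`. -/
noncomputable def qApprox (n : ℕ) (P : ℂ) : ℂ :=
  P - (2 * n - 1) / 8 * P⁻¹ ^ 2 - (12 * n ^ 2 - 12 * n + 5) / 128 * P⁻¹ ^ 5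

/-- The first three terms of the asymptotic expansion of `(log τ_n)''`. -/
noncomputable def uApprox (n : ℕ) (P : ℂ) : ℂ :=
  n / 4 * (P⁻¹ + n / 4 * P⁻¹ ^ 4 + (20 * n ^ 2 + 5) / 128 * P⁻¹ ^ 7)

section Branch

variable {σ : ℝ} (hσ : σ ^ 2 = 1)

include hσ

theorem branch_sq {x : ℝ} (hx : 0 ≤ x) : branch σ x ^ 2 = x / 2 := by
  rw [branch, ← Complex.ofReal_pow, mul_pow, hσ, one_mul, Real.sq_sqrt (by positivity)]
  push_cast
  rfl

theorem branch_ne_zero {x : ℝ} (hx : 0 < x) : branch σ x ≠ 0 := by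
  intro h
  have := branch_sq hσ hx.le
  rw [h] at this
  have : (x : ℂ) = 0 := by linear_combination -2 * this
  exact hx.ne' (by exact_mod_cast this)

/-- From `P ^ 2 = x / 2`. Derivatives of polynomials in `P⁻¹` are again such polynomials, so all
residuals below are computed algebraically. -/
theorem hasDerivAt_branch {x : ℝ} (hx : 0 < x) :
    HasDerivAt (branch σ) (1 / 4 * (branch σ x)⁻¹) x := by
  have h1 : HasDerivAt (fun x : ℝ => σ * Real.sqrt (x / 2))
      (σ * (1 / 2 / (2 * Real.sqrt (x / 2)))) x :=
    (((hasDerivAt_id x).div_const 2).sqrt (by positivity)).const_mul σ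
  have h2 := h1.ofReal_comp
  refine h2.congr_deriv ?_
  have h3 : σ * (1 / 2 / (2 * Real.sqrt (x / 2))) = 1 / 4 * (σ * Real.sqrt (x / 2))⁻¹ := by
    have h4 : σ ≠ 0 := by rintro rfl; norm_num at hσ
    have h5 : Real.sqrt (x / 2) ≠ 0 := by positivity
    field_simp
    linear_combination 4 * hσ
  rw [h3, branch]
  push_cast
  ring

theorem norm_branch (x : ℝ) : ‖branch σ x‖ = Real.sqrt (x / 2) := by
  have : |σ| = 1 := by rcases mul_self_eq_one_iff.1 (sq σ ▸ hσ) with rfl | rfl <;> simp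
  rw [branch, Complex.norm_real, norm_mul, Real.norm_eq_abs, this, one_mul,
    Real.norm_of_nonneg (Real.sqrt_nonneg _)]

theorem hasDerivAt_branch_inv_pow (k : ℕ) {x : ℝ} (hx : 0 < x) :
    HasDerivAt (fun x => (branch σ x)⁻¹ ^ k) (-(k / 4) * (branch σ x)⁻¹ ^ (k + 2)) x := by
  have h0 := branch_ne_zero hσ hx
  refine (((hasDerivAt_branch hσ hx).inv h0).pow k).congr_deriv ?_
  rcases k with _ | k
  · simp
  · simp only [Pi.inv_apply, Nat.add_sub_cancel]
    rw [div_eq_mul_inv _ (branch σ x ^ 2), ← inv_pow]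
    push_cast
    ring

theorem hasDerivAt_qApprox (n : ℕ) {x : ℝ} (hx : 0 < x) :
    HasDerivAt (fun x => qApprox n (branch σ x))
      (1 / 4 * (branch σ x)⁻¹ + (2 * n - 1) / 16 * (branch σ x)⁻¹ ^ 4
        + 5 / 512 * (12 * n ^ 2 - 12 * n + 5) * (branch σ x)⁻¹ ^ 7) x := by
  refine (((hasDerivAt_branch hσ hx).sub
    ((hasDerivAt_branch_inv_pow hσ 2 hx).const_mul ((2 * n - 1) / 8 : ℂ))).sub
    ((hasDerivAt_branch_inv_pow hσ 5 hx).const_mul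
      ((12 * n ^ 2 - 12 * n + 5) / 128 : ℂ))).congr_deriv ?_
  push_cast
  ring

theorem hasDerivAt_uApprox (n : ℕ) {x : ℝ} (hx : 0 < x) :
    HasDerivAt (fun x => uApprox n (branch σ x))
      (-(n / 16) * ((branch σ x)⁻¹ ^ 3 + n * (branch σ x)⁻¹ ^ 6
        + 7 / 128 * (20 * n ^ 2 + 5) * (branch σ x)⁻¹ ^ 9)) x := by
  have h1 := hasDerivAt_branch_inv_pow hσ 1 hx
  simp only [pow_one] at h1
  refine (((h1.add
    ((hasDerivAt_branch_inv_pow hσ 4 hx).const_mul (n / 4 : ℂ))).add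
    ((hasDerivAt_branch_inv_pow hσ 7 hx).const_mul
      ((20 * n ^ 2 + 5) / 128 : ℂ))).const_mul (n / 4 : ℂ)).congr_deriv ?_
  push_cast
  ring

theorem tendsto_norm_branch : Tendsto (fun x => ‖branch σ x‖) atTop atTop := by
  simp only [norm_branch hσ]
  exact Real.tendsto_sqrt_atTop.comp (tendsto_id.atTop_div_const two_pos)

theorem isBigO_branch_inv_pow {j k : ℕ} (h : j ≤ k) :
    (fun x => (branch σ x)⁻¹ ^ k) =O[atTop] fun x => (branch σ x)⁻¹ ^ j := by
  refine IsBigO.of_bound 1 ?_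
  filter_upwards [(tendsto_norm_branch hσ).eventually_ge_atTop 1] with x hx
  rw [one_mul, norm_pow, norm_pow, norm_inv]
  exact pow_le_pow_of_le_one (by positivity) (inv_le_one_of_one_le₀ hx) h

theorem tendsto_branch_inv : Tendsto (fun x => (branch σ x)⁻¹) atTop (nhds 0) := by
  rw [tendsto_zero_iff_norm_tendsto_zero]
  simp only [norm_inv]
  exact (tendsto_norm_branch hσ).inv_tendsto_atTop

theorem isBigO_branch_pow (k : ℕ) : (fun x => branch σ x ^ k) =O[atTop] fun x : ℝ => x ^ k := by
  refine IsBigO.pow ?_ k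
  refine IsBigO.of_bound 1 ?_
  filter_upwards [eventually_ge_atTop 1] with x hx
  rw [one_mul, norm_branch hσ, Real.norm_of_nonneg (by positivity)]
  apply Real.sqrt_le_iff.2
  constructor <;> nlinarith

theorem eventually_branch_ne_zero : ∀ᶠ x in atTop, branch σ x ≠ 0 := by
  filter_upwards [eventually_gt_atTop 0] with x hx using branch_ne_zero hσ hx

theorem eventually_norm_le_mul_sqrt {r : ℝ → ℂ} (hr : r =O[atTop] branch σ) :
    ∃ M, ∀ᶠ x in atTop, ‖r x‖ ≤ M * Real.sqrt x := by
  obtain ⟨M, hM, h⟩ := hr.exists_pos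
  refine ⟨M, ?_⟩
  filter_upwards [h.bound, eventually_ge_atTop 0] with x hx hx0
  refine hx.trans ?_
  rw [norm_branch hσ]
  gcongr
  linarith

/-- The right side is `2 √(x / 2) ≥ 1.4 √x`, and `c ^ 2 ≤ x / 8` keeps `|c|` below the spare `0.4
√x`. -/
theorem sqrt_le_branch_re {x : ℝ} {c : ℝ} (hx : c ^ 2 ≤ x / 8) (hx0 : 0 ≤ x) :
    Real.sqrt x + c ≤ 2 * σ * (branch σ x).re := by
  have h1 : 2 * σ * (branch σ x).re = 2 * Real.sqrt (x / 2) := by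
    rw [branch, Complex.ofReal_re]
    linear_combination 2 * Real.sqrt (x / 2) * hσ
  rw [h1]
  have h2 := Real.sq_sqrt hx0
  have h3 := Real.sq_sqrt (show 0 ≤ x / 2 by positivity)
  have h6 := Real.sqrt_nonneg x
  have h7 : |c| ≤ 4 / 10 * Real.sqrt x :=
    abs_le_of_sq_le_sq (by rw [mul_pow, h2]; linarith) (by positivity)
  have h8 : Real.sqrt x * (7 / 10) ≤ Real.sqrt (x / 2) := by
    apply Real.le_sqrt_of_sq_le
    rw [mul_pow, h2]
    linarith
  linarith [le_abs_self c]

/-- A solution of moderate growth of a linear equation with coefficient close to `-2P` and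
inhomogeneity `O(P)` is bounded. -/
theorem isBigO_one_of_hasDerivAt {f a r : ℝ → ℂ} {k : ℕ}
    (hf : ∀ᶠ x in atTop, HasDerivAt f (a x * f x + r x) x)
    (ha : (fun x => a x + 2 * branch σ x) =O[atTop] fun _ => (1 : ℝ))
    (hr : r =O[atTop] branch σ) (hb : f =O[atTop] fun x : ℝ => x ^ k) :
    f =O[atTop] fun _ => (1 : ℝ) := by
  obtain ⟨M, hM⟩ := eventually_norm_le_mul_sqrt hσ hr
  obtain ⟨A, hA⟩ := ha.bound
  have hre : ∀ᶠ x in atTop, σ * (a x).re ≤ -(1 * Real.sqrt x) := by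
    filter_upwards [hA, eventually_ge_atTop (8 * A ^ 2), eventually_ge_atTop 0] with x h1 h2 h0
    rw [norm_one, mul_one] at h1
    have h3 := sqrt_le_branch_re hσ (c := A) (x := x) (by linarith) h0
    have h4 : |σ| = 1 := by rcases mul_self_eq_one_iff.1 (sq σ ▸ hσ) with rfl | rfl <;> simp
    have h5 := (Complex.abs_re_le_norm (a x + 2 * branch σ x)).trans h1
    have h6 : σ * (a x + 2 * branch σ x).re ≤ A := by
      refine (le_abs_self _).trans ?_
      rwa [abs_mul, h4, one_mul]
    have h7 : (a x + 2 * branch σ x).re = (a x).re + 2 * (branch σ x).re := by simp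
    rw [h7] at h6
    linarith
  obtain ⟨T, hT⟩ := eventually_atTop.1 (hf.and (hM.and (hre.and (eventually_gt_atTop 0))))
  have hT0 := (hT T le_rfl).2.2.2
  -- The coefficient is close to `-2 P`: stable for `σ = 1`; unstable for `σ = -1`, where the growth
  -- bound `hb` excludes the exponentially large solutions.
  rcases mul_self_eq_one_iff.1 (sq σ ▸ hσ) with rfl | rfl
  · refine isBigO_one_of_stable hT0 one_pos (fun x hx => (hT x hx).1) (fun x hx => ?_)
      (fun x hx => (hT x hx).2.1)
    simpa using (hT x hx).2.2.1
  · refine IsBigO.of_bound (M / 1) ?_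
    filter_upwards [eventually_ge_atTop T] with x hx
    rw [norm_one, mul_one]
    refine norm_le_of_unstable hT0 one_pos (fun x hx => (hT x hx).1) (fun x hx => ?_)
      (fun x hx => (hT x hx).2.1) hb x hx
    have := (hT x hx).2.2.1
    linarith

end Branch

/-! ### The system for `q_n`, `u_n` and its Bäcklund transformation -/

/-- The differential system satisfied by `q_n` and `u_n = (log τ_n)''` as functions of `x = -z`,
with the asymptotic expansion of `q_n` and a growth bound for `u_n`. -/
structure AirySystem (σ : ℝ) (n : ℕ) (q u : ℝ → ℂ) : Prop where
  deriv_q : ∀ᶠ x in atTop, HasDerivAt q (q x ^ 2 - x / 2 + 2 * u x) x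
  deriv_u : ∀ᶠ x in atTop, HasDerivAt u (-2 * q x * u x + n / 2) x
  isBigO_q : (fun x => q x - qApprox n (branch σ x)) =O[atTop] fun x => (branch σ x)⁻¹ ^ 8
  isBigO_u : u =O[atTop] fun x : ℝ => x ^ 2

theorem isBigO_branch_polynomial {σ : ℝ} (hσ : σ ^ 2 = 1) (j : ℕ) (A B : ℂ) :
    (fun x => A * (branch σ x)⁻¹ ^ j + B * (branch σ x)⁻¹ ^ (j + 3))
      =O[atTop] fun x => (branch σ x)⁻¹ ^ j :=
  ((isBigO_refl _ _).const_mul_left _).add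
    ((isBigO_branch_inv_pow hσ (by omega)).const_mul_left _)

theorem isBigO_uApprox {σ : ℝ} (hσ : σ ^ 2 = 1) (n : ℕ) :
    (fun x => uApprox n (branch σ x)) =O[atTop] fun x => (branch σ x)⁻¹ := by
  have h4 := isBigO_branch_inv_pow hσ (show 1 ≤ 4 by norm_num)
  have h7 := isBigO_branch_inv_pow hσ (show 1 ≤ 7 by norm_num)
  simp only [pow_one] at h4 h7
  exact (((isBigO_refl _ _).add (h4.const_mul_left _)).add (h7.const_mul_left _)).const_mul_left _

theorem isBigO_qApprox_sub {σ : ℝ} (hσ : σ ^ 2 = 1) (n : ℕ) :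
    (fun x => qApprox n (branch σ x) - branch σ x) =O[atTop] fun _ => (1 : ℝ) := by
  have h2 := isBigO_branch_inv_pow hσ (show 0 ≤ 2 by norm_num)
  have h5 := isBigO_branch_inv_pow hσ (show 0 ≤ 5 by norm_num)
  simp only [pow_zero] at h2 h5
  have := ((h2.const_mul_left (-((2 * n - 1) / 8 : ℂ))).sub
    (h5.const_mul_left ((12 * n ^ 2 - 12 * n + 5) / 128 : ℂ)))
  refine (this.congr_left fun x => ?_).trans (isBigO_of_le _ (by simp))
  simp only [qApprox]
  ring

theorem isBigO_id_of_isBigO_sub_qApprox {σ : ℝ} (hσ : σ ^ 2 = 1) {n : ℕ} {q : ℝ → ℂ}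
    (h : (fun x => q x - qApprox n (branch σ x)) =O[atTop] fun x => (branch σ x)⁻¹ ^ 8) :
    q =O[atTop] fun x : ℝ => x := by
  have h8 := isBigO_branch_inv_pow hσ (show 0 ≤ 8 by norm_num)
  simp only [pow_zero] at h8
  have h1 : (fun _ : ℝ => (1 : ℂ)) =O[atTop] fun x : ℝ => x := by
    refine IsBigO.of_bound 1 ?_
    filter_upwards [eventually_ge_atTop 1] with x hx
    rw [norm_one, one_mul, Real.norm_of_nonneg (by positivity)]
    exact hx
  have h2 := isBigO_branch_pow hσ 1
  simp only [pow_one] at h2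
  refine (((h.trans (h8.trans h1)).add
    ((isBigO_qApprox_sub hσ n).trans (IsBigO.trans (isBigO_of_le _ (by simp)) h1))).add
    h2).congr_left fun x => ?_
  ring

theorem isBigO_ofReal_div_two : (fun x : ℝ => (x : ℂ) / 2) =O[atTop] fun x : ℝ => x ^ 2 := by
  refine IsBigO.of_bound 1 ?_
  filter_upwards [eventually_ge_atTop 1] with x hx
  rw [norm_div, Complex.norm_real, one_mul, Real.norm_of_nonneg (by positivity),
    Real.norm_of_nonneg (by positivity)]
  norm_num
  nlinarith

namespace AirySystem

variable {σ : ℝ} {n : ℕ} {q u : ℝ → ℂ}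

/-- With `U` and `Q` the approximations, `(u - U) P ^ 10` solves a linear equation with coefficient
`-2 P + O(1)`. Its inhomogeneity is `O(P)`, since both `(q - Q) U` and the residual of `U` are
`O(P⁻¹ ^ 9)`. -/
theorem isBigO_u_sub (hσ : σ ^ 2 = 1) (h : AirySystem σ n q u) :
    (fun x => u x - uApprox n (branch σ x)) =O[atTop] fun x => (branch σ x)⁻¹ ^ 10 := by
  have hne := eventually_branch_ne_zero hσ
  -- The residual `U' + 2 Q U - n / 2`; the coefficients of `uApprox` cancel every term before `P⁻¹
  -- ^ 9`.
  set E : ℝ → ℂ := fun x =>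
    -(n / 2 * ((2 * n - 1) * (20 * n ^ 2 + 5) / 1024 + n * (12 * n ^ 2 - 12 * n + 5) / 512)
      + 7 * n * (20 * n ^ 2 + 5) / 2048) * (branch σ x)⁻¹ ^ 9
    + -(n * (12 * n ^ 2 - 12 * n + 5) * (20 * n ^ 2 + 5) / 32768) * (branch σ x)⁻¹ ^ 12 with hE
  have hEO : E =O[atTop] fun x => (branch σ x)⁻¹ ^ 9 := isBigO_branch_polynomial hσ 9 _ _
  have hU := isBigO_uApprox hσ n
  have key : (fun x => (u x - uApprox n (branch σ x)) * branch σ x ^ 10)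
      =O[atTop] fun _ => (1 : ℝ) := by
    refine isBigO_one_of_hasDerivAt hσ (k := 13)
      (a := fun x => -2 * q x + 5 / 2 * (branch σ x)⁻¹ ^ 2)
      (r := fun x => (-2 * (q x - qApprox n (branch σ x)) * uApprox n (branch σ x) - E x)
        * branch σ x ^ 10) ?_ ?_ ?_ ?_
    · filter_upwards [h.deriv_u, eventually_gt_atTop 0] with x hx hx0
      refine ((hx.sub (hasDerivAt_uApprox hσ n hx0)).mul
        ((hasDerivAt_branch hσ hx0).pow 10)).congr_deriv ?_
      have := branch_ne_zero hσ hx0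
      simp only [hE, qApprox, uApprox, Pi.pow_apply, Pi.sub_apply]
      generalize branch σ x = P at *
      generalize q x = q
      generalize u x = u
      generalize (n : ℂ) = n
      field_simp
      ring
    · have h2 := isBigO_branch_inv_pow hσ (show 0 ≤ 2 by norm_num)
      have h8 := isBigO_branch_inv_pow hσ (show 0 ≤ 8 by norm_num)
      simp only [pow_zero] at h2 h8
      have h1 : (fun _ : ℝ => (1 : ℂ)) =O[atTop] fun _ => (1 : ℝ) := isBigO_of_le _ (by simp)
      refine ((((h.isBigO_q.trans (h8.trans h1)).add (isBigO_qApprox_sub hσ n)).const_mul_left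
        (-2)).add ((h2.trans h1).const_mul_left (5 / 2 : ℂ))).congr_left fun x => ?_
      ring
    · have h1 := ((((h.isBigO_q.const_mul_left (-2)).mul hU).sub
        (hEO.congr_right fun x => pow_succ _ 8)).mul
        (isBigO_refl (fun x => branch σ x ^ 10) atTop))
      refine h1.trans_eventuallyEq ?_
      filter_upwards [hne] with x hx
      field_simp
    · have h1 : (fun x => uApprox n (branch σ x)) =O[atTop] fun x : ℝ => x ^ 2 := by
        have h0 := isBigO_branch_inv_pow hσ (show 0 ≤ 1 by norm_num)
        simp only [pow_zero, pow_one] at h0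
        refine (hU.trans h0).trans (IsBigO.of_bound 1 ?_)
        filter_upwards [eventually_ge_atTop 1] with x hx
        rw [norm_one, one_mul, Real.norm_of_nonneg (by positivity)]
        exact one_le_pow₀ hx
      refine ((h.isBigO_u.sub h1).mul (isBigO_branch_pow hσ 10)).trans
        (IsBigO.of_bound 1 ?_)
      filter_upwards [eventually_ge_atTop 1] with x hx
      rw [one_mul, Real.norm_of_nonneg (by positivity), Real.norm_of_nonneg (by positivity),
        ← pow_add]
      exact pow_le_pow_right₀ hx (by norm_num)
  have h2 := (key.trans (isBigO_of_le (g := fun _ => (1 : ℂ)) _ (by simp))).mul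
    (isBigO_refl (fun x => (branch σ x)⁻¹ ^ 10) atTop)
  simp only [one_mul] at h2
  refine h2.congr' ?_ (EventuallyEq.refl _ _)
  filter_upwards [hne] with x hx
  field_simp

theorem tendsto_uApprox_mul (hσ : σ ^ 2 = 1) (n : ℕ) :
    Tendsto (fun x => uApprox n (branch σ x) * branch σ x) atTop (nhds (n / 4)) := by
  have hi := tendsto_branch_inv hσ
  have h1 : Tendsto (fun x => (n / 4 : ℂ) * (1 + n / 4 * (branch σ x)⁻¹ ^ 3
      + (20 * n ^ 2 + 5) / 128 * (branch σ x)⁻¹ ^ 6)) atTop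
      (nhds ((n / 4 : ℂ) * (1 + n / 4 * 0 ^ 3 + (20 * n ^ 2 + 5) / 128 * 0 ^ 6))) :=
    (((((hi.pow 3).const_mul _).const_add _).add ((hi.pow 6).const_mul _)).const_mul _)
  have h2 : (n / 4 : ℂ) * (1 + n / 4 * 0 ^ 3 + (20 * n ^ 2 + 5) / 128 * 0 ^ 6) = n / 4 := by
    ring
  rw [h2] at h1
  refine h1.congr' ?_
  filter_upwards [eventually_branch_ne_zero hσ] with x hx
  rw [uApprox]
  field_simp

theorem tendsto_u_mul (hσ : σ ^ 2 = 1) (h : AirySystem σ n q u) :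
    Tendsto (fun x => u x * branch σ x) atTop (nhds (n / 4)) := by
  have h1 : Tendsto (fun x => (u x - uApprox n (branch σ x)) * branch σ x) atTop (nhds 0) := by
    have h9 : Tendsto (fun x => (branch σ x)⁻¹ ^ 9) atTop (nhds 0) := by
      simpa using (tendsto_branch_inv hσ).pow 9
    refine IsBigO.trans_tendsto ?_ h9
    refine ((h.isBigO_u_sub hσ).mul (isBigO_refl (branch σ) atTop)).trans_eventuallyEq ?_
    filter_upwards [eventually_branch_ne_zero hσ] with x hx
    field_simp
  have h2 := h1.add (tendsto_uApprox_mul hσ n)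
  rw [zero_add] at h2
  exact h2.congr fun x => by ring

theorem isBigO_inv_of_tendsto (hσ : σ ^ 2 = 1) (hn : n ≠ 0) {v : ℝ → ℂ}
    (h : Tendsto (fun x => v x * branch σ x) atTop (nhds (n / 4))) :
    (fun x => (v x)⁻¹) =O[atTop] branch σ := by
  have h0 : (n / 4 : ℂ) ≠ 0 := by simpa using hn
  have h1 := ((h.inv₀ h0).isBigO_one ℂ).mul (isBigO_refl (branch σ) atTop)
  simp only [one_mul] at h1
  refine h1.congr' ?_ (EventuallyEq.refl _ _)
  filter_upwards [eventually_branch_ne_zero hσ] with x hx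
  rw [mul_inv, mul_assoc, inv_mul_cancel₀ hx, mul_one]

theorem eventually_ne_zero_of_tendsto (hn : n ≠ 0) {v : ℝ → ℂ}
    (h : Tendsto (fun x => v x * branch σ x) atTop (nhds (n / 4))) :
    ∀ᶠ x in atTop, v x ≠ 0 := by
  have h0 : (n / 4 : ℂ) ≠ 0 := by simpa using hn
  filter_upwards [h.eventually_ne h0] with x hx
  exact left_ne_zero_of_mul hx

theorem eventually_u_ne_zero (hσ : σ ^ 2 = 1) (hn : n ≠ 0) (h : AirySystem σ n q u) :
    ∀ᶠ x in atTop, u x ≠ 0 :=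
  eventually_ne_zero_of_tendsto hn (h.tendsto_u_mul hσ)

/-- The approximations satisfy the Bäcklund relation up to `F = O(P⁻¹ ^ 9)`. The error splits into
`-(q - Q)`, `-(n / 2) (u - U) / (u U)` and `F / U`, each `O(P⁻¹ ^ 8)` because `1 / u` and `1 / U`
are `O(P)`. -/
theorem isBigO_backlund (hσ : σ ^ 2 = 1) (hn : n ≠ 0) (h : AirySystem σ n q u) :
    (fun x => (-q x + n / (2 * u x)) - qApprox (n + 1) (branch σ x))
      =O[atTop] fun x => (branch σ x)⁻¹ ^ 8 := by
  have hU := tendsto_uApprox_mul hσ n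
  set F : ℝ → ℂ := fun x =>
    (n / 4 * (n * (20 * n ^ 2 + 5) / 256 + n * (24 * n ^ 2 + 10) / 512)) * (branch σ x)⁻¹ ^ 9
    + (n / 4 * ((20 * n ^ 2 + 5) * (24 * n ^ 2 + 10) / 16384)) * (branch σ x)⁻¹ ^ 12 with hF
  have hFO : F =O[atTop] fun x => (branch σ x)⁻¹ ^ 9 := isBigO_branch_polynomial hσ 9 _ _
  have hU' := isBigO_inv_of_tendsto hσ hn hU
  have hu' := isBigO_inv_of_tendsto hσ hn (h.tendsto_u_mul hσ)
  have h1 : (fun x => -(n / 2 : ℂ) * ((u x - uApprox n (branch σ x))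
      * ((u x)⁻¹ * (uApprox n (branch σ x))⁻¹)))
      =O[atTop] fun x => (branch σ x)⁻¹ ^ 8 := by
    refine (((h.isBigO_u_sub hσ).mul (hu'.mul hU')).const_mul_left _).trans_eventuallyEq ?_
    filter_upwards [eventually_branch_ne_zero hσ] with x hx
    field_simp
  have h2 : (fun x => F x * (uApprox n (branch σ x))⁻¹)
      =O[atTop] fun x => (branch σ x)⁻¹ ^ 8 := by
    refine (hFO.mul hU').trans_eventuallyEq ?_
    filter_upwards [eventually_branch_ne_zero hσ] with x hx
    field_simp
  refine ((h.isBigO_q.neg_left.add h1).add h2).congr' ?_ (EventuallyEq.refl _ _)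
  filter_upwards [eventually_branch_ne_zero hσ, h.eventually_u_ne_zero hσ hn,
    eventually_ne_zero_of_tendsto hn hU] with x hx hu hU0
  have h3 : (qApprox n (branch σ x) + qApprox (n + 1) (branch σ x)) * uApprox n (branch σ x)
      = n / 2 - F x := by
    simp only [hF, qApprox, uApprox]
    push_cast
    generalize branch σ x = P at *
    generalize (n : ℂ) = n
    field_simp
    ring
  generalize uApprox n (branch σ x) = U at *
  generalize qApprox n (branch σ x) = Q at *
  generalize qApprox (n + 1) (branch σ x) = R at *
  generalize q x = q at *
  generalize u x = u at *
  generalize F x = F at *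
  field_simp
  linear_combination (2 * u) * h3

/-- The Bäcklund transformation of the system. -/
theorem succ (hσ : σ ^ 2 = 1) (hn : n ≠ 0) (h : AirySystem σ n q u) {q' u' : ℝ → ℂ}
    (hu : ∀ᶠ x in atTop, HasDerivAt u (-(u x * (q x - q' x))) x)
    (hq' : ∀ᶠ x in atTop, HasDerivAt q' (u' x - u x) x) : AirySystem σ (n + 1) q' u' := by
  have hrel : ∀ᶠ x in atTop, u x * (q x + q' x) = n / 2 := by
    filter_upwards [hu, h.deriv_u] with x h1 h2
    linear_combination h1.unique h2
  have hq'eq : ∀ᶠ x in atTop, -q x + n / (2 * u x) = q' x := by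
    filter_upwards [hrel, h.eventually_u_ne_zero hσ hn] with x h1 h2
    field_simp
    linear_combination -2 * h1
  have hu'eq : ∀ᶠ x in atTop, u' x = -(q' x) ^ 2 + x / 2 - u x := by
    filter_upwards [hq', h.deriv_q, hu, eventually_atTop_eventually_nhds hrel,
      h.eventually_u_ne_zero hσ hn] with x h1 h2 h3 h4 h5
    -- Differentiating the Bäcklund relation and cancelling `u ≠ 0` yields the Riccati-type formula
    -- for `u'`.
    have h6 : HasDerivAt (fun x => u x * (q x + q' x)) 0 x :=
      (hasDerivAt_const x (n / 2 : ℂ)).congr_of_eventuallyEq h4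
    have h7 := h6.unique (h3.mul (h2.add h1))
    have h8 : u x * (u' x - (-(q' x) ^ 2 + x / 2 - u x)) = 0 := by
      linear_combination -h7
    linear_combination (mul_eq_zero.1 h8).resolve_left h5
  have hasym : (fun x => q' x - qApprox (n + 1) (branch σ x))
      =O[atTop] fun x => (branch σ x)⁻¹ ^ 8 := by
    refine (h.isBigO_backlund hσ hn).congr' ?_ (EventuallyEq.refl _ _)
    filter_upwards [hq'eq] with x hx
    rw [hx]
  refine ⟨?_, ?_, hasym, ?_⟩
  · filter_upwards [hq', hu'eq] with x h1 h2
    refine h1.congr_deriv ?_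
    linear_combination -h2
  · filter_upwards [eventually_atTop_eventually_nhds hu'eq, hq', hu, hrel] with x h1 h2 h3 h4
    have h5 : HasDerivAt (fun x : ℝ => (x : ℂ) / 2) (1 / 2) x :=
      (Complex.ofRealCLM.hasDerivAt (x := x)).div_const 2
    have h6 := (((h2.pow 2).neg.add h5).sub h3).congr_of_eventuallyEq h1
    refine h6.congr_deriv ?_
    push_cast
    linear_combination h4
  · have h1 := isBigO_id_of_isBigO_sub_qApprox hσ hasym
    have h3 := isBigO_ofReal_div_two
    refine (((h1.pow 2).neg_left.add h3).sub h.isBigO_u).congr' ?_ (EventuallyEq.refl _ _)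
    filter_upwards [hu'eq] with x hx
    rw [hx]

end AirySystem

/-! ### The case `n = 1`: logarithmic derivatives of Airy solutions -/

theorem norm_branch_inv_pow_eight {σ : ℝ} (hσ : σ ^ 2 = 1) {x : ℝ} (hx : 0 < x) :
    ‖(branch σ x)⁻¹ ^ 8‖ = 16 * x ^ (-4 : ℤ) := by
  have h := Real.sq_sqrt (show 0 ≤ x / 2 by positivity)
  rw [norm_pow, norm_inv, norm_branch hσ, inv_pow,
    show Real.sqrt (x / 2) ^ 8 = (Real.sqrt (x / 2) ^ 2) ^ 4 by ring, h, zpow_neg]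
  have : x ^ (4 : ℤ) = x ^ 4 := by norm_cast
  rw [this]
  field_simp
  norm_num

/-- The residual of the Riccati equation `Q' + Q² = x / 2` at `qApprox 1`. -/
noncomputable def riccatiResidual (σ x : ℝ) : ℂ :=
  15 / 256 * (branch σ x)⁻¹ ^ 7 + 25 / 16384 * (branch σ x)⁻¹ ^ 10

theorem isBigO_riccatiResidual {σ : ℝ} (hσ : σ ^ 2 = 1) :
    riccatiResidual σ =O[atTop] fun x => (branch σ x)⁻¹ ^ 7 :=
  isBigO_branch_polynomial hσ 7 _ _

theorem hasDerivAt_qApprox_one {σ : ℝ} (hσ : σ ^ 2 = 1) {x : ℝ} (hx : 0 < x) :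
    HasDerivAt (fun x => qApprox 1 (branch σ x))
      (x / 2 - qApprox 1 (branch σ x) ^ 2 + riccatiResidual σ x) x := by
  refine (hasDerivAt_qApprox hσ 1 hx).congr_deriv ?_
  rw [← branch_sq hσ hx.le]
  have := branch_ne_zero hσ hx
  simp only [qApprox, riccatiResidual]
  push_cast
  generalize branch σ x = P at *
  field_simp
  ring

theorem eventually_qApprox_re {σ : ℝ} (hσ : σ ^ 2 = 1) (n : ℕ) (B : ℝ) :
    ∀ᶠ x in atTop, 1 / 2 * Real.sqrt x + B ≤ σ * (qApprox n (branch σ x)).re := by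
  obtain ⟨A, hA⟩ := (isBigO_qApprox_sub hσ n).bound
  filter_upwards [hA, eventually_ge_atTop (8 * (2 * (A + B)) ^ 2), eventually_ge_atTop 0]
    with x h1 h2 h0
  rw [norm_one, mul_one] at h1
  have h3 := sqrt_le_branch_re hσ (c := 2 * (A + B)) (x := x) (by linarith) h0
  have h4 : |σ| = 1 := by rcases mul_self_eq_one_iff.1 (sq σ ▸ hσ) with rfl | rfl <;> simp
  have h5 := (Complex.abs_re_le_norm (qApprox n (branch σ x) - branch σ x)).trans h1
  have h6 : -A ≤ σ * (qApprox n (branch σ x) - branch σ x).re := by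
    refine (abs_le.1 ?_).1
    rwa [abs_mul, h4, one_mul]
  rw [Complex.sub_re] at h6
  linarith

section Base

variable {y y' : ℝ → ℂ} (hy : ∀ x, HasDerivAt y (y' x) x)
  (hy' : ∀ x : ℝ, HasDerivAt y' ((x / 2 : ℂ) * y x) x)

include hy hy'

theorem hasDerivAt_div_of_airy {x : ℝ} (hx : y x ≠ 0) :
    HasDerivAt (fun x => y' x / y x) (x / 2 - (y' x / y x) ^ 2) x := by
  refine ((hy' x).div (hy x) hx).congr_deriv ?_
  field_simp

theorem isBigO_div_sub_of_unbounded (hb : Tendsto (fun x => ‖y x‖) atTop atTop) :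
    (fun x => y' x / y x - qApprox 1 (branch 1 x)) =O[atTop] fun x => (branch 1 x)⁻¹ ^ 8 := by
  have hσ : (1 : ℝ) ^ 2 = 1 := by norm_num
  have hr : (fun x => -riccatiResidual 1 x * branch 1 x ^ 8) =O[atTop] branch 1 := by
    refine ((isBigO_riccatiResidual hσ).neg_left.mul
      (isBigO_refl (fun x => branch 1 x ^ 8) atTop)).trans_eventuallyEq ?_
    filter_upwards [eventually_branch_ne_zero hσ] with x hx
    field_simp
  obtain ⟨M, hM⟩ := eventually_norm_le_mul_sqrt hσ hr
  have hne : ∀ᶠ x in atTop, y x ≠ 0 := by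
    filter_upwards [hb.eventually_gt_atTop 0] with x hx using norm_pos_iff.1 hx
  have hinv : ∀ᶠ x in atTop, ‖2 * (branch 1 x)⁻¹ ^ 2‖ ≤ 2 := by
    filter_upwards [(tendsto_norm_branch hσ).eventually_ge_atTop 1] with x hx
    rw [norm_mul, norm_pow, norm_inv]
    have := pow_le_one₀ (n := 2) (by positivity) (inv_le_one_of_one_le₀ hx)
    have h2 : ‖(2 : ℂ)‖ = 2 := by simp
    rw [h2]
    linarith
  -- The margin `2` in `eventually_qApprox_re` absorbs the term `2 P⁻¹ ^ 2` that comes from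
  -- differentiating `P ^ 8`; positivity of the inner product gives `Re (y' / y) ≥ 0`.
  obtain ⟨T, hT⟩ := eventually_atTop.1 (hM.and (hne.and (hinv.and ((eventually_gt_atTop 0).and
    ((eventually_inner_deriv_pos hy' hy hb).and (eventually_qApprox_re hσ 1 2))))))
  have key : (fun x => (y' x / y x - qApprox 1 (branch 1 x)) * branch 1 x ^ 8)
      =O[atTop] fun _ => (1 : ℝ) := by
    refine isBigO_one_of_stable (T := T) (c := 1 / 2) (M := M)
      (a := fun x => -(y' x / y x + qApprox 1 (branch 1 x)) + 2 * (branch 1 x)⁻¹ ^ 2)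
      (hT T le_rfl).2.2.2.1 (by norm_num) (fun x hx => ?_) (fun x hx => ?_)
      (fun x hx => (hT x hx).1)
    · obtain ⟨-, h2, -, h4, -⟩ := hT x hx
      refine (((hasDerivAt_div_of_airy hy hy' h2).sub (hasDerivAt_qApprox_one hσ h4)).mul
        ((hasDerivAt_branch hσ h4).pow 8)).congr_deriv ?_
      have := branch_ne_zero hσ h4
      simp only [Pi.pow_apply, Pi.sub_apply]
      generalize branch 1 x = P at *
      generalize qApprox 1 P = Q
      generalize y' x / y x = q
      field_simp
      ring
    · obtain ⟨-, h2, h3, -, h5, h6⟩ := hT x hx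
      have h7 : 0 ≤ (y' x / y x).re := by
        have h8 : y' x = y' x / y x * y x + 0 := by field_simp; ring
        rw [h8, inner_mul_add, inner_zero_right, add_zero] at h5
        exact (pos_of_mul_pos_left h5 (sq_nonneg _)).le
      have h9 := (Complex.re_le_norm _).trans h3
      simp only [Complex.add_re, Complex.neg_re]
      linarith
  have h2 := (key.trans (isBigO_of_le (g := fun _ => (1 : ℂ)) _ (by simp))).mul
    (isBigO_refl (fun x => (branch 1 x)⁻¹ ^ 8) atTop)
  simp only [one_mul] at h2
  refine h2.congr' ?_ (EventuallyEq.refl _ _)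
  filter_upwards [eventually_branch_ne_zero hσ] with x hx
  field_simp

theorem isBigO_div_sub_of_bounded {C : ℝ} (hb : ∀ x, 0 ≤ x → ‖y x‖ ≤ C)
    (hne : ∀ᶠ x in atTop, y x ≠ 0) :
    (fun x => y' x / y x - qApprox 1 (branch (-1) x))
      =O[atTop] fun x => (branch (-1) x)⁻¹ ^ 8 := by
  have hσ : (-1 : ℝ) ^ 2 = 1 := by norm_num
  obtain ⟨M, hM0, hM⟩ := (isBigO_riccatiResidual hσ).exists_pos
  have hres : ∀ᶠ x in atTop,
      ‖riccatiResidual (-1) x‖ ≤ M * 16 * x ^ (-4 : ℤ) * Real.sqrt x := by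
    filter_upwards [hM.bound, eventually_gt_atTop 0] with x h1 h2
    refine h1.trans ?_
    have h3 : ‖(branch (-1) x)⁻¹ ^ 7‖ = ‖(branch (-1) x)⁻¹ ^ 8‖ * Real.sqrt (x / 2) := by
      rw [← norm_branch hσ, ← norm_mul]
      have := branch_ne_zero hσ h2
      congr 1
      field_simp
    rw [h3, norm_branch_inv_pow_eight hσ h2]
    have h4 : Real.sqrt (x / 2) ≤ Real.sqrt x := Real.sqrt_le_sqrt (by linarith)
    calc _ ≤ M * (16 * x ^ (-4 : ℤ) * Real.sqrt x) := by gcongr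
      _ = _ := by ring
  obtain ⟨T, hT⟩ := eventually_atTop.1 (hres.and (hne.and ((eventually_gt_atTop 0).and
    (eventually_qApprox_re hσ 1 0))))
  have hgrow : (fun x => qApprox 1 (branch (-1) x)) =O[atTop] fun x : ℝ => x ^ 2 := by
    have h1 : (fun x : ℝ => x) =O[atTop] fun x : ℝ => x ^ 2 := by
      refine IsBigO.of_bound 1 ?_
      filter_upwards [eventually_ge_atTop 1] with x hx
      rw [one_mul, Real.norm_of_nonneg (by positivity), Real.norm_of_nonneg (by positivity)]
      nlinarith
    refine (isBigO_id_of_isBigO_sub_qApprox hσ (n := 1) ?_).trans h1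
    simpa using isBigO_zero _ _
  refine IsBigO.of_bound (M * 16 / (1 / 2)) ?_
  filter_upwards [eventually_ge_atTop T] with x hx
  have h1 := norm_div_sub_le_of_bounded hy' hy hb (Q := fun x => qApprox 1 (branch (-1) x))
    (Q' := fun x => x / 2 - qApprox 1 (branch (-1) x) ^ 2 + riccatiResidual (-1) x)
    (hT T le_rfl).2.2.1 (show (0 : ℝ) < 1 / 2 by norm_num) (fun t ht => (hT t ht).2.1)
    (fun t ht => hasDerivAt_qApprox_one hσ (hT t ht).2.2.1)
    (fun t ht => by
      have := (hT t ht).2.2.2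
      rw [Complex.neg_re]
      linarith)
    (fun t ht => by
      refine Eq.trans_le ?_ (hT t ht).1
      congr 1
      ring) hgrow hx
  have hx0 := (hT x hx).2.2.1
  rw [norm_branch_inv_pow_eight hσ hx0]
  refine h1.trans ?_
  have : 0 ≤ x ^ (-4 : ℤ) := by positivity
  gcongr
  linarith

theorem airySystem_one {σ : ℝ} (hσ : σ ^ 2 = 1) (hne : ∀ᶠ x in atTop, y x ≠ 0)
    (h : (fun x => y' x / y x - qApprox 1 (branch σ x)) =O[atTop] fun x => (branch σ x)⁻¹ ^ 8) :
    AirySystem σ 1 (fun x => y' x / y x) (fun x => x / 2 - (y' x / y x) ^ 2) := by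
  refine ⟨?_, ?_, h, ?_⟩
  · filter_upwards [hne] with x hx
    refine (hasDerivAt_div_of_airy hy hy' hx).congr_deriv ?_
    ring
  · filter_upwards [hne] with x hx
    have h5 : HasDerivAt (fun x : ℝ => (x : ℂ) / 2) (1 / 2) x :=
      (Complex.ofRealCLM.hasDerivAt (x := x)).div_const 2
    refine (h5.sub ((hasDerivAt_div_of_airy hy hy' hx).pow 2)).congr_deriv ?_
    push_cast
    ring
  · exact isBigO_ofReal_div_two.sub ((isBigO_id_of_isBigO_sub_qApprox hσ h).pow 2)

end Base

/-! ### The functions `φ` and `τ_n`, and the induction on `n` -/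

theorem cube_airyScale : (((2 : ℝ) ^ (-(1 / 3) : ℝ) : ℝ) : ℂ) ^ 3 = 1 / 2 := by
  rw [← Complex.ofReal_pow, ← Real.rpow_natCast, ← Real.rpow_mul (by norm_num)]
  norm_num

/-- `φ'' = -(z / 2) φ`. -/
theorem exists_hasDerivAt_airyPhi (ϑ : ℂ) :
    ∃ f' : ℂ → ℂ, (∀ z, HasDerivAt (airyPhi ϑ) (f' z) z) ∧
      ∀ z, HasDerivAt f' (-(z / 2) * airyPhi ϑ z) z := by
  obtain ⟨a, ha, ha'⟩ := exists_hasDerivAt_airyAi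
  obtain ⟨b, hb, hb'⟩ := exists_hasDerivAt_airyBi
  have hc := cube_airyScale
  set c : ℂ := (((2 : ℝ) ^ (-(1 / 3) : ℝ) : ℝ) : ℂ) with hcdef
  have hlin : ∀ z, HasDerivAt (fun z : ℂ => -c * z) (-c) z := fun z => by
    simpa using (hasDerivAt_id z).const_mul (-c)
  refine ⟨fun z => Complex.cos ϑ * (a (-c * z) * -c) + Complex.sin ϑ * (b (-c * z) * -c),
    fun z => ?_, fun z => ?_⟩
  · exact (((ha _).comp z (hlin z)).const_mul _).add (((hb _).comp z (hlin z)).const_mul _)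
  · refine (((((ha' _).comp z (hlin z)).mul_const (-c)).const_mul _).add
      ((((hb' _).comp z (hlin z)).mul_const (-c)).const_mul _)).congr_deriv ?_
    simp only [airyPhi, ← hcdef]
    linear_combination
      (-z * (Complex.cos ϑ * airyAi (-c * z) + Complex.sin ϑ * airyBi (-c * z))) * hc

theorem airyPhi_neg_ofReal (ϑ : ℂ) (x : ℝ) :
    airyPhi ϑ (-(x : ℂ)) = Complex.cos ϑ * airyAi (((2 : ℝ) ^ (-(1 / 3) : ℝ) * x : ℝ) : ℂ)
      + Complex.sin ϑ * airyBi (((2 : ℝ) ^ (-(1 / 3) : ℝ) * x : ℝ) : ℂ) := by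
  rw [airyPhi, neg_mul_neg, ← Complex.ofReal_mul]

theorem airyScale_pos : (0 : ℝ) < (2 : ℝ) ^ (-(1 / 3) : ℝ) := by positivity

theorem exists_norm_airyPhi_le {ϑ : ℂ} (h : Complex.sin ϑ = 0) :
    ∃ C, ∀ x : ℝ, 0 ≤ x → ‖airyPhi ϑ (-(x : ℂ))‖ ≤ C := by
  obtain ⟨C, hC⟩ := exists_norm_airyAi_le
  refine ⟨‖Complex.cos ϑ‖ * C, fun x hx => ?_⟩
  rw [airyPhi_neg_ofReal, h, zero_mul, add_zero, norm_mul]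
  gcongr
  exact hC _ (mul_nonneg airyScale_pos.le hx)

theorem tendsto_norm_airyPhi {ϑ : ℂ} (h : Complex.sin ϑ ≠ 0) :
    Tendsto (fun x : ℝ => ‖airyPhi ϑ (-(x : ℂ))‖) atTop atTop := by
  obtain ⟨C, hC⟩ := exists_norm_airyAi_le
  have hlim : Tendsto (fun x : ℝ => (2 : ℝ) ^ (-(1 / 3) : ℝ) * x) atTop atTop :=
    Tendsto.const_mul_atTop airyScale_pos tendsto_id
  have h1 := tendsto_atTop_add_const_right atTop (-(‖Complex.cos ϑ‖ * C))
    (Tendsto.const_mul_atTop (norm_pos_iff.2 h) (tendsto_norm_airyBi.comp hlim))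
  refine tendsto_atTop_mono' _ ?_ h1
  filter_upwards [eventually_ge_atTop 0] with x hx
  rw [airyPhi_neg_ofReal]
  simp only [Function.comp]
  rw [← norm_mul]
  have h2 := norm_sub_le_norm_add (Complex.sin ϑ * airyBi (((2 : ℝ) ^ (-(1 / 3) : ℝ) * x : ℝ) : ℂ))
    (Complex.cos ϑ * airyAi (((2 : ℝ) ^ (-(1 / 3) : ℝ) * x : ℝ) : ℂ))
  have h3 : ‖Complex.cos ϑ * airyAi (((2 : ℝ) ^ (-(1 / 3) : ℝ) * x : ℝ) : ℂ)‖
      ≤ ‖Complex.cos ϑ‖ * C := by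
    rw [norm_mul]
    gcongr
    exact hC _ (mul_nonneg airyScale_pos.le hx)
  rw [add_comm] at h2
  linarith

theorem hasDerivAt_comp_neg_ofReal {f : ℂ → ℂ} {f' : ℂ} {x : ℝ}
    (h : HasDerivAt f f' (-(x : ℂ))) : HasDerivAt (fun x : ℝ => f (-(x : ℂ))) (-f') x := by
  have h1 : HasDerivAt (fun z : ℂ => f (-z)) (-f') (x : ℂ) :=
    (h.comp (x : ℂ) (hasDerivAt_neg (x : ℂ))).congr_deriv (by ring)
  exact h1.comp_ofReal

/-- By the identity theorem `φ` would vanish everywhere, whereas `φ(0) = cos ϑ Ai(0)` and `cos ϑ ≠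
0`. -/
theorem airyPhi_not_eventually_zero {ϑ : ℂ} (h : Complex.sin ϑ = 0) (x₀ : ℝ) :
    ∃ x, x₀ ≤ x ∧ airyPhi ϑ (-(x : ℂ)) ≠ 0 := by
  by_contra! hz
  obtain ⟨f', hf', -⟩ := exists_hasDerivAt_airyPhi ϑ
  have han : AnalyticOnNhd ℂ (airyPhi ϑ) Set.univ :=
    DifferentiableOn.analyticOnNhd (fun z _ => (hf' z).differentiableAt.differentiableWithinAt)
      isOpen_univ
  have htend : Tendsto (fun x : ℝ => -(x : ℂ)) (nhdsWithin (x₀ + 1) {x₀ + 1}ᶜ)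
      (nhdsWithin (-((x₀ + 1 : ℝ) : ℂ)) {-((x₀ + 1 : ℝ) : ℂ)}ᶜ) := by
    refine tendsto_nhdsWithin_of_tendsto_nhds_of_eventually_within _ ?_ ?_
    · exact (Complex.continuous_ofReal.neg.tendsto _).mono_left nhdsWithin_le_nhds
    · filter_upwards [self_mem_nhdsWithin] with x hx hx'
      simp only [Set.mem_singleton_iff, neg_inj, Complex.ofReal_inj] at hx'
      exact hx hx'
  have hev : ∀ᶠ x : ℝ in nhdsWithin (x₀ + 1) {x₀ + 1}ᶜ, airyPhi ϑ (-(x : ℂ)) = 0 := by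
    filter_upwards [nhdsWithin_le_nhds (Ioi_mem_nhds (lt_add_one x₀))] with x hx
    exact hz x hx.le
  have h0 := han.eqOn_zero_of_preconnected_of_frequently_eq_zero isPreconnected_univ
    (Set.mem_univ _) (htend.frequently hev.frequently)
  have h1 := h0 (Set.mem_univ 0)
  simp only [airyPhi, h, mul_zero, zero_mul, add_zero, Pi.zero_apply] at h1
  have h2 : Complex.cos ϑ ≠ 0 := fun hc => by
    have := Complex.sin_sq_add_cos_sq ϑ
    simp [h, hc] at this
  exact (mul_ne_zero h2 airyAi_zero_ne_zero) h1

theorem hasDerivAt_iteratedDeriv_airyPhi (ϑ : ℂ) (k : ℕ) (z : ℂ) :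
    HasDerivAt (iteratedDeriv k (airyPhi ϑ)) (iteratedDeriv (k + 1) (airyPhi ϑ) z) z := by
  obtain ⟨f', hf', -⟩ := exists_hasDerivAt_airyPhi ϑ
  have hd : Differentiable ℂ (airyPhi ϑ) := fun z => (hf' z).differentiableAt
  have h : Differentiable ℂ (iteratedDeriv k (airyPhi ϑ)) :=
    (hd.contDiff (n := (k + 1 : ℕ))).differentiable_iteratedDeriv k
      (by exact_mod_cast k.lt_succ_self)
  rw [iteratedDeriv_succ]
  exact (h z).hasDerivAt

theorem exists_hasDerivAt_airyTau (ϑ : ℂ) (m : ℕ) :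
    ∃ t' t'' : ℂ → ℂ, (∀ z, HasDerivAt (airyTau (m + 1) ϑ) (t' z) z) ∧
      (∀ z, HasDerivAt t' (t'' z) z) ∧
      ∀ z, airyTau m ϑ z ≠ 0 →
        airyTau (m + 2) ϑ z * airyTau m ϑ z = airyTau (m + 1) ϑ z * t'' z - t' z ^ 2 :=
  exists_hasDerivAt_hankel (hasDerivAt_iteratedDeriv_airyPhi ϑ) m

theorem airyTau_zero (ϑ : ℂ) : airyTau 0 ϑ = fun _ => 1 := by
  ext z
  simp [airyTau]

theorem airyTau_one (ϑ : ℂ) : airyTau 1 ϑ = airyPhi ϑ := by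
  ext z
  simp [airyTau]

theorem differentiable_airyTau (ϑ : ℂ) (n : ℕ) : Differentiable ℂ (airyTau n ϑ) := by
  rcases n with _ | m
  · rw [airyTau_zero]
    exact differentiable_const _
  · obtain ⟨t', -, h, -⟩ := exists_hasDerivAt_airyTau ϑ m
    exact fun z => (h z).differentiableAt

/-- `(log τ_{m+1})''`, expressed through the Toda equation. -/
noncomputable def airyToda (m : ℕ) (ϑ z : ℂ) : ℂ :=
  airyTau (m + 2) ϑ z * airyTau m ϑ z / airyTau (m + 1) ϑ z ^ 2

theorem hasDerivAt_logDeriv_airyTau {ϑ z : ℂ} {m : ℕ} (h0 : airyTau m ϑ z ≠ 0)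
    (h1 : airyTau (m + 1) ϑ z ≠ 0) :
    HasDerivAt (logDeriv (airyTau (m + 1) ϑ)) (airyToda m ϑ z) z := by
  obtain ⟨t', t'', h, h', htoda⟩ := exists_hasDerivAt_airyTau ϑ m
  have hl : logDeriv (airyTau (m + 1) ϑ) = fun z => t' z / airyTau (m + 1) ϑ z := by
    ext w
    rw [logDeriv_apply, (h w).deriv]
  rw [hl]
  refine ((h' z).div (h z) h1).congr_deriv ?_
  rw [airyToda, htoda z h0]
  ring

theorem hasDerivAt_airyToda {ϑ z : ℂ} {m : ℕ} (h0 : airyTau m ϑ z ≠ 0)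
    (h1 : airyTau (m + 1) ϑ z ≠ 0) (h2 : airyTau (m + 2) ϑ z ≠ 0) :
    HasDerivAt (airyToda m ϑ) (airyToda m ϑ z *
      ((logDeriv (airyTau m ϑ) z - logDeriv (airyTau (m + 1) ϑ) z)
        - (logDeriv (airyTau (m + 1) ϑ) z - logDeriv (airyTau (m + 2) ϑ) z))) z := by
  have d := fun n => (differentiable_airyTau ϑ n z).hasDerivAt
  refine (((d (m + 2)).mul (d m)).div ((d (m + 1)).pow 2) (pow_ne_zero 2 h1)).congr_deriv ?_
  simp only [airyToda, logDeriv_apply, Pi.pow_apply, Pi.mul_apply]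
  field_simp
  ring

theorem airyQ_succ {ϑ z : ℂ} {m : ℕ} (h0 : airyTau m ϑ z ≠ 0) (h1 : airyTau (m + 1) ϑ z ≠ 0) :
    airyQ (m + 1) ϑ z = logDeriv (airyTau m ϑ) z - logDeriv (airyTau (m + 1) ϑ) z :=
  logDeriv_div z h0 h1 (differentiable_airyTau ϑ m z) (differentiable_airyTau ϑ (m + 1) z)

theorem exists_airySystem_base (ϑ : ℂ) (σ : ℝ)
    (hσ : Complex.sin ϑ = 0 ∧ σ = -1 ∨ Complex.sin ϑ ≠ 0 ∧ σ = 1) :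
    ∃ f' : ℂ → ℂ, (∀ z, HasDerivAt (airyPhi ϑ) (f' z) z) ∧
      (∀ z, HasDerivAt f' (-(z / 2) * airyPhi ϑ z) z) ∧
      (∀ᶠ x : ℝ in atTop, airyPhi ϑ (-(x : ℂ)) ≠ 0) ∧
      AirySystem σ 1 (fun x => -f' (-(x : ℂ)) / airyPhi ϑ (-(x : ℂ)))
        (fun x => x / 2 - (-f' (-(x : ℂ)) / airyPhi ϑ (-(x : ℂ))) ^ 2) := by
  obtain ⟨f', hf, hf'⟩ := exists_hasDerivAt_airyPhi ϑ
  have hy : ∀ x : ℝ, HasDerivAt (fun x : ℝ => airyPhi ϑ (-(x : ℂ))) (-f' (-(x : ℂ))) x :=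
    fun x => hasDerivAt_comp_neg_ofReal (hf _)
  have hy' : ∀ x : ℝ, HasDerivAt (fun x : ℝ => -f' (-(x : ℂ)))
      ((x / 2 : ℂ) * airyPhi ϑ (-(x : ℂ))) x := fun x => by
    refine (hasDerivAt_comp_neg_ofReal (hf' _)).neg.congr_deriv ?_
    ring
  refine ⟨f', hf, hf', ?_⟩
  rcases hσ with ⟨hs, rfl⟩ | ⟨hs, rfl⟩
  · obtain ⟨C, hC⟩ := exists_norm_airyPhi_le hs
    have hne : ∀ᶠ x : ℝ in atTop, airyPhi ϑ (-(x : ℂ)) ≠ 0 := by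
      -- As `‖y‖` is decreasing, one zero on the half-line would make `y` vanish from there on.
      filter_upwards [eventually_ge_atTop 0] with x hx hzero
      obtain ⟨t, ht, hne⟩ := airyPhi_not_eventually_zero hs x
      have h1 := antitoneOn_norm_of_bounded hy' hy hC hx (hx.trans ht) ht
      simp only [hzero, norm_zero] at h1
      exact hne (norm_le_zero_iff.1 h1)
    exact ⟨hne, airySystem_one hy hy' (by norm_num) hne (isBigO_div_sub_of_bounded hy hy' hC hne)⟩
  · have hb := tendsto_norm_airyPhi hs
    have hne : ∀ᶠ x : ℝ in atTop, airyPhi ϑ (-(x : ℂ)) ≠ 0 := by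
      filter_upwards [hb.eventually_gt_atTop 0] with x hx using norm_pos_iff.1 hx
    exact ⟨hne, airySystem_one hy hy' (by norm_num) hne (isBigO_div_sub_of_unbounded hy hy' hb)⟩

theorem AirySystem.congr {σ : ℝ} {n : ℕ} {q u q' u' : ℝ → ℂ} (h : AirySystem σ n q u)
    (hq : q =ᶠ[atTop] q') (hu : u =ᶠ[atTop] u') : AirySystem σ n q' u' := by
  refine ⟨?_, ?_, ?_, h.isBigO_u.congr' hu (EventuallyEq.refl _ _)⟩
  · filter_upwards [h.deriv_q, hq, hu, eventually_atTop_eventually_nhds hq] with x h1 h2 h3 h4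
    rw [← h2, ← h3]
    exact h1.congr_of_eventuallyEq (h4.mono fun _ h => h.symm)
  · filter_upwards [h.deriv_u, hq, hu, eventually_atTop_eventually_nhds hu] with x h1 h2 h3 h4
    rw [← h2, ← h3]
    exact h1.congr_of_eventuallyEq (h4.mono fun _ h => h.symm)
  · refine h.isBigO_q.congr' ?_ (EventuallyEq.refl _ _)
    filter_upwards [hq] with x hx
    rw [hx]

theorem airySystem_airyTau (ϑ : ℂ) (σ : ℝ)
    (hσ : Complex.sin ϑ = 0 ∧ σ = -1 ∨ Complex.sin ϑ ≠ 0 ∧ σ = 1) (m : ℕ) :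
    (∀ᶠ x : ℝ in atTop, airyTau m ϑ (-(x : ℂ)) ≠ 0 ∧ airyTau (m + 1) ϑ (-(x : ℂ)) ≠ 0) ∧
    AirySystem σ (m + 1)
      (fun x => logDeriv (airyTau m ϑ) (-(x : ℂ)) - logDeriv (airyTau (m + 1) ϑ) (-(x : ℂ)))
      (fun x => airyToda m ϑ (-(x : ℂ))) := by
  have hσ2 : σ ^ 2 = 1 := by rcases hσ with ⟨-, rfl⟩ | ⟨-, rfl⟩ <;> norm_num
  induction m with
  | zero =>
    obtain ⟨f', hf, hf', hne, hsys⟩ := exists_airySystem_base ϑ σ hσ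
    refine ⟨?_, hsys.congr (Eventually.of_forall fun x => ?_) ?_⟩
    · filter_upwards [hne] with x hx
      simpa [airyTau_zero, airyTau_one] using hx
    · simp only [airyTau_zero, zero_add, airyTau_one, logDeriv_apply, (hf _).deriv]
      simp [neg_div]
    · filter_upwards [hne] with x hx
      have h1 := hasDerivAt_logDeriv_airyTau (ϑ := ϑ) (z := -(x : ℂ)) (m := 0)
        (by simp [airyTau_zero]) (by simpa [airyTau_one] using hx)
      have hl : logDeriv (airyTau (0 + 1) ϑ) = fun z => f' z / airyPhi ϑ z := by
        ext w
        rw [zero_add, airyTau_one, logDeriv_apply, (hf w).deriv]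
      rw [hl] at h1
      rw [h1.unique ((hf' _).div (hf _) hx)]
      field_simp
  | succ m ih =>
    obtain ⟨hne, hsys⟩ := ih
    -- The next determinant is a factor of the Toda quotient, which is eventually nonzero by its
    -- asymptotics.
    have hne2 : ∀ᶠ x : ℝ in atTop, airyTau (m + 2) ϑ (-(x : ℂ)) ≠ 0 := by
      filter_upwards [hsys.eventually_u_ne_zero hσ2 m.succ_ne_zero] with x hx h0
      exact hx (by simp [airyToda, h0])
    refine ⟨(hne.and hne2).mono fun x hx => ⟨hx.1.2, hx.2⟩,
      hsys.succ hσ2 m.succ_ne_zero ?_ ?_⟩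
    · filter_upwards [hne, hne2] with x hx hx2
      exact hasDerivAt_comp_neg_ofReal (hasDerivAt_airyToda hx.1 hx.2 hx2)
    · filter_upwards [hne, hne2] with x hx hx2
      refine (hasDerivAt_comp_neg_ofReal ((hasDerivAt_logDeriv_airyTau hx.1 hx.2).sub
        (hasDerivAt_logDeriv_airyTau hx.2 hx2))).congr_deriv ?_
      ring

/-! ### Return to the variable `z` -/

theorem qApprox_branch_neg {σ : ℝ} (hσ : σ ^ 2 = 1) (n : ℕ) {z : ℝ} (hz : z < 0) :
    qApprox n (branch σ (-z)) =
      ((σ * ((-z) ^ (1 / 2 : ℝ) / Real.sqrt 2) + (2 * (n : ℝ) - 1) / (4 * z)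
        - σ * ((12 * (n : ℝ) ^ 2 - 12 * (n : ℝ) + 5)
          / (16 * Real.sqrt 2 * (-z) ^ (5 / 2 : ℝ))) : ℝ) : ℂ) := by
  have hx : 0 < -z := by linarith
  have h2 : Real.sqrt 2 ^ 2 = 2 := Real.sq_sqrt (by norm_num)
  have h2' : Real.sqrt 2 ≠ 0 := by positivity
  have hs : Real.sqrt (-z) ^ 2 = -z := Real.sq_sqrt hx.le
  have hs' : Real.sqrt (-z) ≠ 0 := (Real.sqrt_pos.2 hx).ne'
  have h5 : (-z) ^ (5 / 2 : ℝ) = Real.sqrt (-z) ^ 5 := by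
    rw [Real.sqrt_eq_rpow, ← Real.rpow_natCast, ← Real.rpow_mul hx.le]
    norm_num
  have hz' : z = -Real.sqrt (-z) ^ 2 := by rw [hs, neg_neg]
  rw [h5, ← Real.sqrt_eq_rpow, qApprox, branch, Real.sqrt_div hx.le]
  -- Here `s = √(-z)` and `w = √2`. The sign `σ` survives only in odd powers of `P`, so the middle
  -- term is the same on both branches.
  have key : ∀ s w : ℝ, s ≠ 0 → w ≠ 0 → w ^ 2 = 2 → ∀ c d : ℝ,
      σ * (s / w) - c / 8 * (σ * (s / w))⁻¹ ^ 2 - d / 128 * (σ * (s / w))⁻¹ ^ 5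
        = σ * (s / w) + c / (4 * -s ^ 2) - σ * (d / (16 * w * s ^ 5)) := by
    intro s w hs hw hw2 c d
    have hi : σ⁻¹ = σ := inv_eq_of_mul_eq_one_left (by rw [← sq, hσ])
    have e2 : (σ * (s / w))⁻¹ ^ 2 = 2 / s ^ 2 := by
      rw [mul_inv, hi, mul_pow, hσ, one_mul, inv_div, div_pow, hw2]
    have e5 : (σ * (s / w))⁻¹ ^ 5 = σ * (8 / (w * s ^ 5)) := by
      rw [mul_inv, hi, mul_pow, show σ ^ 5 = (σ ^ 2) ^ 2 * σ by ring, hσ, inv_div, div_pow]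
      have : w ^ 5 = 8 / w := by
        rw [eq_div_iff hw, show w ^ 5 * w = (w ^ 2) ^ 3 by ring, hw2]
        norm_num
      rw [this]
      field_simp
    rw [e2, e5]
    field_simp
    ring
  have := key (Real.sqrt (-z)) (Real.sqrt 2) hs' h2' h2 (2 * (n : ℝ) - 1)
    (12 * (n : ℝ) ^ 2 - 12 * (n : ℝ) + 5)
  rw [← hz'] at this
  rw [← this]
  push_cast
  rfl

theorem airyQ_asymptotics (ϑ : ℂ) (σ : ℝ)
    (hσ : Complex.sin ϑ = 0 ∧ σ = -1 ∨ Complex.sin ϑ ≠ 0 ∧ σ = 1) (n : ℕ) (hn : 1 ≤ n) :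
    (fun z : ℝ => airyQ n ϑ (z : ℂ) -
        ((σ * ((-z) ^ (1 / 2 : ℝ) / Real.sqrt 2) + (2 * (n : ℝ) - 1) / (4 * z)
          - σ * ((12 * (n : ℝ) ^ 2 - 12 * (n : ℝ) + 5)
              / (16 * Real.sqrt 2 * (-z) ^ (5 / 2 : ℝ))) : ℝ) : ℂ))
        =O[atBot] (fun z : ℝ => z ^ (-4 : ℤ)) := by
  have hσ2 : σ ^ 2 = 1 := by rcases hσ with ⟨-, rfl⟩ | ⟨-, rfl⟩ <;> norm_num
  obtain ⟨m, rfl⟩ : ∃ m, n = m + 1 := ⟨n - 1, by omega⟩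
  obtain ⟨hne, hsys⟩ := airySystem_airyTau ϑ σ hσ m
  have h1 := hsys.isBigO_q.trans (g := fun x => (branch σ x)⁻¹ ^ 8)
    (k := fun x : ℝ => x ^ (-4 : ℤ)) <| by
      refine IsBigO.of_bound 16 ?_
      filter_upwards [eventually_gt_atTop 0] with x hx
      rw [norm_branch_inv_pow_eight hσ2 hx, Real.norm_of_nonneg (by positivity)]
  have h2 := h1.comp_tendsto tendsto_neg_atBot_atTop
  refine h2.congr' ?_ (Eventually.of_forall fun z => ?_)
  · filter_upwards [tendsto_neg_atBot_atTop.eventually hne, eventually_lt_atBot 0] with z hz hz0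
    simp only [Complex.ofReal_neg, neg_neg] at hz
    simp only [Function.comp, Complex.ofReal_neg, neg_neg]
    rw [airyQ_succ hz.1 hz.2, qApprox_branch_neg hσ2 (m + 1) hz0]
  · simp only [Function.comp]
    exact Even.neg_zpow (by decide) z

theorem theorem3p3 (n : ℕ) (hn : 1 ≤ n) (ϑ : ℂ) :
    (Complex.sin ϑ = 0 →
      (fun z : ℝ => airyQ n ϑ (z : ℂ) -
        ((-((-z) ^ (1 / 2 : ℝ) / Real.sqrt 2) + (2 * (n : ℝ) - 1) / (4 * z)
          + (12 * (n : ℝ) ^ 2 - 12 * (n : ℝ) + 5)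
              / (16 * Real.sqrt 2 * (-z) ^ (5 / 2 : ℝ)) : ℝ) : ℂ))
        =O[atBot] (fun z : ℝ => z ^ (-4 : ℤ))) ∧
    (Complex.sin ϑ ≠ 0 →
      (fun z : ℝ => airyQ n ϑ (z : ℂ) -
        (((-z) ^ (1 / 2 : ℝ) / Real.sqrt 2 + (2 * (n : ℝ) - 1) / (4 * z)
          - (12 * (n : ℝ) ^ 2 - 12 * (n : ℝ) + 5)
              / (16 * Real.sqrt 2 * (-z) ^ (5 / 2 : ℝ)) : ℝ) : ℂ))
        =O[atBot] (fun z : ℝ => z ^ (-4 : ℤ))) := by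
  refine ⟨fun h => ?_, fun h => ?_⟩
  · simpa only [neg_one_mul, sub_neg_eq_add] using airyQ_asymptotics ϑ (-1) (.inl ⟨h, rfl⟩) n hn
  · simpa only [one_mul] using airyQ_asymptotics ϑ 1 (.inr ⟨h, rfl⟩) n hn
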